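/- **Conventions.** Rings are associative with unit, bimodules are unital. For a map $f$ into an abelian group write $\langle f\rangle(x,y)=f(x)+f(y)-f(x+y)$. **Mac Lane cohomology.** Let $R$ be a ring and $B$ an $R$-bimodule. $C^3(R;B)$ is the group (under valuewise addition) of quadruples $\varphi=(\varphi_\cdot,\varphi_{\cdot+},\varphi_{+\cdot},\varphi_+)$ of maps $\varphi_\cdot,\varphi_{\cdot+},\varphi_{+\cdot}:R^3\to B$, $\varphi_+:R^4\to B$ (the arguments of $\varphi_+$ are written as $2\times2$ matrices) that are normalized: $\varphi_\cdot,\varphi_{\cdot+},\varphi_{+\cdot}$ vanish if one argument is $0$, and $\varphi_+$ vanishes on all matrices $\left(\begin{smallmatrix}x&y\\0&0\end{smallmatrix}\right)$, $\left(\begin{smallmatrix}0&0\\x&y\end{smallmatrix}\right)$, $\left(\begin{smallmatrix}x&0\\y&0\end{smallmatrix}\right)$, $\left(\begin{smallmatrix}0&x\\0&y\end{smallmatrix}\right)$, $\left(\begin{smallmatrix}x&0\\0&y\end{smallmatrix}\right)$. $Z^3(R;B)$ is the subgroup of those that satisfy, for all elements of $R$, 1. $r\varphi_\cdot(s,t,u)-\varphi_\cdot(rs,t,u)+\varphi_\cdot(r,st,u)-\varphi_\cdot(r,s,tu)+\varphi_\cdot(r,s,t)u=0$;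 2. $r\varphi_{\cdot+}(s,t_0,t_1)-\varphi_{\cdot+}(rs,t_0,t_1)+\varphi_{\cdot+}(r,st_0,st_1)=\langle\varphi_\cdot(r,s,-)\rangle(t_0,t_1)$; 3. $\varphi_{\cdot+}(r,s_0t,s_1t)-\varphi_{\cdot+}(r,s_0,s_1)t=\varphi_{+\cdot}(rs_0,rs_1,t)-r\varphi_{+\cdot}(s_0,s_1,t)+\langle\varphi_\cdot(r,-,t)\rangle(s_0,s_1)$; 4. $\varphi_{+\cdot}(r_0s,r_1s,t)-\varphi_{+\cdot}(r_0,r_1,st)+\varphi_{+\cdot}(r_0,r_1,s)t=-\langle\varphi_\cdot(-,s,t)\rangle(r_0,r_1)$; 5. $\varphi_+\left(\begin{smallmatrix}rs_{00}&rs_{01}\\rs_{10}&rs_{11}\end{smallmatrix}\right)-r\varphi_+\left(\begin{smallmatrix}s_{00}&s_{01}\\s_{10}&s_{11}\end{smallmatrix}\right)=\langle\varphi_{\cdot+}(r,-,-)\rangle((s_{00},s_{10}),(s_{01},s_{11}))-\langle\varphi_{\cdot+}(r,-,-)\rangle((s_{00},s_{01}),(s_{10},s_{11}))$; 6. $\varphi_+\left(\begin{smallmatrix}r_0s_0&r_0s_1\\r_1s_0&r_1s_1\end{smallmatrix}\right)=\langle\varphi_{+\cdot}(r_0,r_1,-)\rangle(s_0,s_1)-\langle\varphi_{\cdot+}(-,s_0,s_1)\rangle(r_0,r_1)$;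 7. $\varphi_+\left(\begin{smallmatrix}r_{00}s&r_{01}s\\r_{10}s&r_{11}s\end{smallmatrix}\right)-\varphi_+\left(\begin{smallmatrix}r_{00}&r_{01}\\r_{10}&r_{11}\end{smallmatrix}\right)s=\langle\varphi_{+\cdot}(-,-,s)\rangle((r_{00},r_{10}),(r_{01},r_{11}))-\langle\varphi_{+\cdot}(-,-,s)\rangle((r_{00},r_{01}),(r_{10},r_{11}))$; 8. $\langle\varphi_+\rangle\left(\left(\begin{smallmatrix}r_{000}&r_{001}\\r_{010}&r_{011}\end{smallmatrix}\right),\left(\begin{smallmatrix}r_{100}&r_{101}\\r_{110}&r_{111}\end{smallmatrix}\right)\right)-\langle\varphi_+\rangle\left(\left(\begin{smallmatrix}r_{000}&r_{001}\\r_{100}&r_{101}\end{smallmatrix}\right),\left(\begin{smallmatrix}r_{010}&r_{011}\\r_{110}&r_{111}\end{smallmatrix}\right)\right)+\langle\varphi_+\rangle\left(\left(\begin{smallmatrix}r_{000}&r_{010}\\r_{100}&r_{110}\end{smallmatrix}\right),\left(\begin{smallmatrix}r_{001}&r_{011}\\r_{101}&r_{111}\end{smallmatrix}\right)\right)=0$.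 $B^3(R;B)\subseteq Z^3(R;B)$ is the subgroup of those $\varphi\in C^3(R;B)$ for which there are maps $\gamma_\cdot,\gamma_+:R^2\to B$ with $\varphi_\cdot(r,s,t)=r\gamma_\cdot(s,t)-\gamma_\cdot(rs,t)+\gamma_\cdot(r,st)-\gamma_\cdot(r,s)t$, $\ \varphi_{\cdot+}(r,s_0,s_1)=r\gamma_+(s_0,s_1)-\gamma_+(rs_0,rs_1)+\langle\gamma_\cdot(r,-)\rangle(s_0,s_1)$, $\ \varphi_{+\cdot}(r_0,r_1,s)=\gamma_+(r_0,r_1)s-\gamma_+(r_0s,r_1s)+\langle\gamma_\cdot(-,s)\rangle(r_0,r_1)$ and $\varphi_+\left(\begin{smallmatrix}r_{00}&r_{01}\\r_{10}&r_{11}\end{smallmatrix}\right)=\langle\gamma_+\rangle((r_{00},r_{01}),(r_{10},r_{11}))-\langle\gamma_+\rangle((r_{00},r_{10}),(r_{01},r_{11}))$. Put $H^3(R;B)=Z^3(R;B)/B^3(R;B)$. **Categorical rings.** A categorical ring $\mathscr R$ is a symmetric monoidal groupoid $(\mathscr R,+,0)$ with a chosen object $-a$ and a chosen isomorphism $-a+a\to0$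 for each object $a$, together with a second monoidal structure $(\cdot,1)$ on $\mathscr R$ and natural isomorphisms $r(s_0+s_1)\to rs_0+rs_1$ and $(r_0+r_1)s\to r_0s+r_1s$ such that - the two canonical isomorphisms built from the distributivity and multiplicative associativity constraints agree in each of the cases $(rs)(t_0+t_1)\to r(st_0)+r(st_1)$, $(r(s_0+s_1))t\to r(s_0t)+r(s_1t)$, $((r_0+r_1)s)t\to r_0(st)+r_1(st)$; - the distributivity constraints at $1(r_0+r_1)$ and $(r_0+r_1)1$ are compatible with the multiplicative unit constraints; - the distributivity constraints are compatible with the canonical interchange isomorphisms $(a+b)+(c+d)\to(a+c)+(b+d)$: the two canonical isomorphisms $r((s_{00}+s_{01})+(s_{10}+s_{11}))\to(rs_{00}+rs_{10})+(rs_{01}+rs_{11})$ agree, likewise for multiplication by $s$ on the right, and the two canonical isomorphisms $(r_0+r_1)(s_0+s_1)\to(r_0s_0+r_1s_0)+(r_0s_1+r_1s_1)$ agree; - with the distributivity constraints, all functors $r\cdot(-)$ and $(-)\cdot s$ are monoidal functors with respect to $+$. A 2-homomorphism of categorical rings is a functor $f$ with structures of a monoidal functor with respect to $+$ and with respect to $\cdot$,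 with structure morphisms $f(r_0)+f(r_1)\to f(r_0+r_1)$ and $f(r)f(s)\to f(rs)$ that are compatible with both distributivity constraints. $\pi_0(\mathscr R)$ is the ring of isomorphism classes of objects of $\mathscr R$, and $\pi_1(\mathscr R)$ is the abelian group $\mathrm{Aut}(0)$, a $\pi_0(\mathscr R)$-bimodule through multiplication and the canonical isomorphisms $r0\cong0\cong0r$. $\mathrm{Crext}(R;B)$ is the class of categorical rings $\mathscr R$ with $\pi_0(\mathscr R)=R$ and $\pi_1(\mathscr R)=B$ (as identifications of rings and of abelian groups) whose induced bimodule structure is the given one, modulo the relation: $\mathscr R\sim\mathscr R'$ if there is a 2-homomorphism $\mathscr R\to\mathscr R'$ that induces the identity on $\pi_0$ and $\pi_1$. *Characteristic cochains.* For $\mathscr R$ as above, choose an object $\bar r$ in each class $r\in R$ and morphisms $\sigma_\cdot(r,s):\bar r\bar s\to\overline{rs}$, $\sigma_+(r,s):\bar r+\bar s\to\overline{r+s}$. For parallel morphisms $\alpha,\alpha'$ let $\alpha'-\alpha\in B$ be the unique element $\beta$ such that $\alpha+\beta$ corresponds to $\alpha'$ under the right unit constraints of $+$. The characteristic cochain of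 these choices is the quadruple with $$\varphi_\cdot(r,s,t)=\sigma_\cdot(r,st)\circ\bar r\sigma_\cdot(s,t)\circ a-\sigma_\cdot(rs,t)\circ\sigma_\cdot(r,s)\bar t,$$ $$\varphi_{\cdot+}(r,s_0,s_1)=\sigma_+(rs_0,rs_1)\circ(\sigma_\cdot(r,s_0)+\sigma_\cdot(r,s_1))\circ d-\sigma_\cdot(r,s_0+s_1)\circ\bar r\sigma_+(s_0,s_1),$$ $$\varphi_{+\cdot}(r_0,r_1,s)=\sigma_+(r_0s,r_1s)\circ(\sigma_\cdot(r_0,s)+\sigma_\cdot(r_1,s))\circ d'-\sigma_\cdot(r_0+r_1,s)\circ\sigma_+(r_0,r_1)\bar s,$$ $$\varphi_+\left(\begin{smallmatrix}r_{00}&r_{01}\\r_{10}&r_{11}\end{smallmatrix}\right)=\sigma_+(r_{00}+r_{10},r_{01}+r_{11})\circ(\sigma_+(r_{00},r_{10})+\sigma_+(r_{01},r_{11}))\circ c-\sigma_+(r_{00}+r_{01},r_{10}+r_{11})\circ(\sigma_+(r_{00},r_{01})+\sigma_+(r_{10},r_{11})),$$ where $a,d,d',c$ are the multiplicative associativity,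 left and right distributivity and interchange isomorphisms at the chosen objects. *Skeletal construction.* For $\varphi\in Z^3(R;B)$, $\mathscr R_\varphi$ is the categorical ring with objects the elements of $R$ and morphisms the pairs $(b,r):r\to r$, $b\in B$, with $(b,r)\circ(b',r)=(b+b',r)$, $(b_0,r_0)+(b_1,r_1)=(b_0+b_1,r_0+r_1)$, $(b,r)(b',r')=(br'+rb',rr')$, neutral objects $0$ and $1$, trivial additive unit constraints, and all other constraints given by their $B$-components: additive associativity $\varphi_+\left(\begin{smallmatrix}r&s\\0&t\end{smallmatrix}\right)$, symmetry $\varphi_+\left(\begin{smallmatrix}0&r\\s&0\end{smallmatrix}\right)$, multiplicative associativity $\varphi_\cdot(r,s,t)$, multiplicative unit constraints $-\varphi_\cdot(1,1,r)$ (left) and $\varphi_\cdot(r,1,1)$ (right), distributivity $\varphi_{\cdot+}(r,s_0,s_1)$ (left) and $\varphi_{+\cdot}(r_0,r_1,s)$ (right). **Theorem.** For any ring $R$ and any $R$-bimodule $B$, the relation $\sim$ is an equivalence relation, and there is a bijection $$H^3(R;B)\cong\mathrm{Crext}(R;B)$$ which sends the class of a cocycle $\varphi$ to the class of $\mathscr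 R_\varphi$, and whose inverse sends the class of $\mathscr R$ to its characteristic class $[\mathscr R]$: every $\mathscr R$ has a normalized characteristic cochain, every normalized characteristic cochain of $\mathscr R$ is a cocycle, and its class in $H^3(R;B)$ corresponds to the class of $\mathscr R$. -/

import Mathlib

set_option linter.unusedSectionVars false
set_option linter.unusedSimpArgs false
set_option linter.unnecessarySeqFocus false
set_option linter.style.longLine false

open CategoryTheory MonoidalCategory
open scoped RightActions

universe v u

/-! ### Categorical rings

The additive structure of a categorical ring is written through the ambient Mathlib instances:
`a ⊗ b` is the sum of the objects `a`, `b`, `f ⊗ₘ g` the sum of morphisms, `𝟙_ C` the zero object,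
`α_`, `λ_`, `ρ_`, `β_` the additive constraints.  The multiplicative structure is a second monoidal
structure, written `r ⊙ s`, `f ⊙ₘ g`. -/

/-- A categorical group: a monoidal groupoid with a chosen inverse `neg a` of every object `a` and
a chosen (iso)morphism `neg a + a ⟶ 0`. -/
class CategoricalGroup (C : Type u) [Groupoid.{v} C] [MonoidalCategory C] where
  neg : C → C
  negHom : ∀ a : C, neg a ⊗ a ⟶ 𝟙_ C

/-- A second, multiplicative, monoidal structure on a category. -/
class MulStructure (C : Type u) [Category.{v} C] where
  mon : MonoidalCategory C

section Multiplicative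

variable {C : Type u} [Category.{v} C] [MulStructure C]

/-- The product of two objects. -/
def mulObj (r s : C) : C := MulStructure.mon.toMonoidalCategoryStruct.tensorObj r s

/-- The product of two morphisms. -/
def mulHom {r r' s s' : C} (f : r ⟶ r') (g : s ⟶ s') : mulObj r s ⟶ mulObj r' s' :=
  MulStructure.mon.toMonoidalCategoryStruct.tensorHom f g

variable (C) in
/-- The multiplicative unit object. -/
def oneObj : C := (MulStructure.mon (C := C)).toMonoidalCategoryStruct.tensorUnit

/-- The multiplicative associativity constraint `(rs)t ≅ r(st)`. -/
def mulAssoc (r s t : C) : mulObj (mulObj r s) t ≅ mulObj r (mulObj s t) :=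
  MulStructure.mon.toMonoidalCategoryStruct.associator r s t

/-- The multiplicative left unit constraint `1r ≅ r`. -/
def oneMul (r : C) : mulObj (oneObj C) r ≅ r :=
  MulStructure.mon.toMonoidalCategoryStruct.leftUnitor r

/-- The multiplicative right unit constraint `r1 ≅ r`. -/
def mulOne (r : C) : mulObj r (oneObj C) ≅ r :=
  MulStructure.mon.toMonoidalCategoryStruct.rightUnitor r

end Multiplicative

infixr:75 " ⊙ " => mulObj
infixr:75 " ⊙ₘ " => mulHom

/-- A categorical ring: a symmetric categorical group with a second monoidal structure and natural
left and right distributivity constraints, subject to coherence.  (The underlying category is a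
groupoid, so all constraints are isomorphisms.)  `tensorμ a b c d` is the canonical
isomorphism `(a + b) + (c + d) ⟶ (a + c) + (b + d)`. -/
class CategoricalRing (C : Type u) [Groupoid.{v} C] [MonoidalCategory C] [SymmetricCategory C]
    [MulStructure C] extends CategoricalGroup C where
  /-- left distributivity -/
  ldis : ∀ r s₀ s₁ : C, r ⊙ (s₀ ⊗ s₁) ⟶ (r ⊙ s₀) ⊗ (r ⊙ s₁)
  /-- right distributivity -/
  rdis : ∀ r₀ r₁ s : C, (r₀ ⊗ r₁) ⊙ s ⟶ (r₀ ⊙ s) ⊗ (r₁ ⊙ s)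
  ldis_natural : ∀ {r r' s₀ s₀' s₁ s₁' : C} (f : r ⟶ r') (g₀ : s₀ ⟶ s₀') (g₁ : s₁ ⟶ s₁'),
    (f ⊙ₘ (g₀ ⊗ₘ g₁)) ≫ ldis r' s₀' s₁' = ldis r s₀ s₁ ≫ ((f ⊙ₘ g₀) ⊗ₘ (f ⊙ₘ g₁))
  rdis_natural : ∀ {r₀ r₀' r₁ r₁' s s' : C} (f₀ : r₀ ⟶ r₀') (f₁ : r₁ ⟶ r₁') (g : s ⟶ s'),
    ((f₀ ⊗ₘ f₁) ⊙ₘ g) ≫ rdis r₀' r₁' s' = rdis r₀ r₁ s ≫ ((f₀ ⊙ₘ g) ⊗ₘ (f₁ ⊙ₘ g))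
  /-- `(rs)(t₀+t₁) ⟶ r(st₀) + r(st₁)` -/
  ldis_assoc : ∀ r s t₀ t₁ : C,
    (mulAssoc r s (t₀ ⊗ t₁)).hom ≫ (𝟙 r ⊙ₘ ldis s t₀ t₁) ≫ ldis r (s ⊙ t₀) (s ⊙ t₁) =
      ldis (r ⊙ s) t₀ t₁ ≫ ((mulAssoc r s t₀).hom ⊗ₘ (mulAssoc r s t₁).hom)
  /-- `(r(s₀+s₁))t ⟶ r(s₀t) + r(s₁t)` -/
  ldis_rdis_assoc : ∀ r s₀ s₁ t : C,
    (ldis r s₀ s₁ ⊙ₘ 𝟙 t) ≫ rdis (r ⊙ s₀) (r ⊙ s₁) t ≫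
        ((mulAssoc r s₀ t).hom ⊗ₘ (mulAssoc r s₁ t).hom) =
      (mulAssoc r (s₀ ⊗ s₁) t).hom ≫ (𝟙 r ⊙ₘ rdis s₀ s₁ t) ≫ ldis r (s₀ ⊙ t) (s₁ ⊙ t)
  /-- `((r₀+r₁)s)t ⟶ r₀(st) + r₁(st)` -/
  rdis_assoc : ∀ r₀ r₁ s t : C,
    (rdis r₀ r₁ s ⊙ₘ 𝟙 t) ≫ rdis (r₀ ⊙ s) (r₁ ⊙ s) t ≫
        ((mulAssoc r₀ s t).hom ⊗ₘ (mulAssoc r₁ s t).hom) =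
      (mulAssoc (r₀ ⊗ r₁) s t).hom ≫ rdis r₀ r₁ (s ⊙ t)
  /-- `1(r₀+r₁) ⟶ r₀+r₁` -/
  ldis_one : ∀ r₀ r₁ : C,
    ldis (oneObj C) r₀ r₁ ≫ ((oneMul r₀).hom ⊗ₘ (oneMul r₁).hom) = (oneMul (r₀ ⊗ r₁)).hom
  /-- `(r₀+r₁)1 ⟶ r₀+r₁` -/
  rdis_one : ∀ r₀ r₁ : C,
    rdis r₀ r₁ (oneObj C) ≫ ((mulOne r₀).hom ⊗ₘ (mulOne r₁).hom) = (mulOne (r₀ ⊗ r₁)).hom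
  /-- `r((s₀₀+s₀₁)+(s₁₀+s₁₁)) ⟶ (rs₀₀+rs₁₀)+(rs₀₁+rs₁₁)` -/
  ldis_interchange : ∀ r s₀₀ s₀₁ s₁₀ s₁₁ : C,
    ldis r (s₀₀ ⊗ s₀₁) (s₁₀ ⊗ s₁₁) ≫ (ldis r s₀₀ s₀₁ ⊗ₘ ldis r s₁₀ s₁₁) ≫
        tensorμ (r ⊙ s₀₀) (r ⊙ s₀₁) (r ⊙ s₁₀) (r ⊙ s₁₁) =
      (𝟙 r ⊙ₘ tensorμ s₀₀ s₀₁ s₁₀ s₁₁) ≫ ldis r (s₀₀ ⊗ s₁₀) (s₀₁ ⊗ s₁₁) ≫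
        (ldis r s₀₀ s₁₀ ⊗ₘ ldis r s₀₁ s₁₁)
  /-- `(r₀+r₁)(s₀+s₁) ⟶ (r₀s₀+r₁s₀)+(r₀s₁+r₁s₁)` -/
  rdis_ldis_interchange : ∀ r₀ r₁ s₀ s₁ : C,
    rdis r₀ r₁ (s₀ ⊗ s₁) ≫ (ldis r₀ s₀ s₁ ⊗ₘ ldis r₁ s₀ s₁) ≫
        tensorμ (r₀ ⊙ s₀) (r₀ ⊙ s₁) (r₁ ⊙ s₀) (r₁ ⊙ s₁) =
      ldis (r₀ ⊗ r₁) s₀ s₁ ≫ (rdis r₀ r₁ s₀ ⊗ₘ rdis r₀ r₁ s₁)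
  /-- `((r₀₀+r₀₁)+(r₁₀+r₁₁))s ⟶ (r₀₀s+r₁₀s)+(r₀₁s+r₁₁s)` -/
  rdis_interchange : ∀ r₀₀ r₀₁ r₁₀ r₁₁ s : C,
    rdis (r₀₀ ⊗ r₀₁) (r₁₀ ⊗ r₁₁) s ≫ (rdis r₀₀ r₀₁ s ⊗ₘ rdis r₁₀ r₁₁ s) ≫
        tensorμ (r₀₀ ⊙ s) (r₀₁ ⊙ s) (r₁₀ ⊙ s) (r₁₁ ⊙ s) =
      (tensorμ r₀₀ r₀₁ r₁₀ r₁₁ ⊙ₘ 𝟙 s) ≫ rdis (r₀₀ ⊗ r₁₀) (r₀₁ ⊗ r₁₁) s ≫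
        (rdis r₀₀ r₁₀ s ⊗ₘ rdis r₀₁ r₁₁ s)
  /-- With `ldis`, the endofunctor `r · -` is a monoidal functor for the addition.  (The unit
  constraint `r0 ⟶ 0` of a monoidal functor between categorical groups, and its compatibility with
  the unit constraints, come for free.) -/
  ldis_add_assoc : ∀ r s₀ s₁ s₂ : C,
    ldis r (s₀ ⊗ s₁) s₂ ≫ (ldis r s₀ s₁ ⊗ₘ 𝟙 (r ⊙ s₂)) ≫ (α_ (r ⊙ s₀) (r ⊙ s₁) (r ⊙ s₂)).hom =
      (𝟙 r ⊙ₘ (α_ s₀ s₁ s₂).hom) ≫ ldis r s₀ (s₁ ⊗ s₂) ≫ (𝟙 (r ⊙ s₀) ⊗ₘ ldis r s₁ s₂)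
  /-- With `rdis`, the endofunctor `- · s` is a monoidal functor for the addition. -/
  rdis_add_assoc : ∀ r₀ r₁ r₂ s : C,
    rdis (r₀ ⊗ r₁) r₂ s ≫ (rdis r₀ r₁ s ⊗ₘ 𝟙 (r₂ ⊙ s)) ≫ (α_ (r₀ ⊙ s) (r₁ ⊙ s) (r₂ ⊙ s)).hom =
      ((α_ r₀ r₁ r₂).hom ⊙ₘ 𝟙 s) ≫ rdis r₀ (r₁ ⊗ r₂) s ≫ (𝟙 (r₀ ⊙ s) ⊗ₘ rdis r₁ r₂ s)

open CategoricalRing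

/-- A 2-homomorphism of categorical rings: a functor `F` with monoidal structures for the addition
and for the multiplication, compatible with both distributivity constraints.  (All categories are
groupoids, so a lax monoidal structure is a strong one: `ε` is the inverse of the
unit constraint `F 0 ⟶ 0`, resp. `F 1 ⟶ 1`.) -/
structure TwoHom (C : Type u) [Groupoid.{v} C] [MonoidalCategory C] [SymmetricCategory C]
    [MulStructure C] [CategoricalRing C]
    (D : Type u) [Groupoid.{v} D] [MonoidalCategory D] [SymmetricCategory D]
    [MulStructure D] [CategoricalRing D] where
  F : C ⥤ D
  addMonoidal : F.LaxMonoidal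
  mulMonoidal : @Functor.LaxMonoidal C _ MulStructure.mon D _ MulStructure.mon F
  /-- `F r (F s₀ + F s₁) ⟶ F (r s₀ + r s₁)` -/
  ldis_comp : ∀ r s₀ s₁ : C,
    ldis (F.obj r) (F.obj s₀) (F.obj s₁) ≫
        (mulMonoidal.μ r s₀ ⊗ₘ mulMonoidal.μ r s₁) ≫ addMonoidal.μ (r ⊙ s₀) (r ⊙ s₁) =
      (𝟙 (F.obj r) ⊙ₘ addMonoidal.μ s₀ s₁) ≫ mulMonoidal.μ r (s₀ ⊗ s₁) ≫ F.map (ldis r s₀ s₁)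
  /-- `(F r₀ + F r₁) F s ⟶ F (r₀ s + r₁ s)` -/
  rdis_comp : ∀ r₀ r₁ s : C,
    rdis (F.obj r₀) (F.obj r₁) (F.obj s) ≫
        (mulMonoidal.μ r₀ s ⊗ₘ mulMonoidal.μ r₁ s) ≫ addMonoidal.μ (r₀ ⊙ s) (r₁ ⊙ s) =
      (addMonoidal.μ r₀ r₁ ⊙ₘ 𝟙 (F.obj s)) ≫ mulMonoidal.μ (r₀ ⊗ r₁) s ≫ F.map (rdis r₀ r₁ s)

/-! ### Mac Lane cochains, cocycles and coboundaries -/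

/-- The cross-effect `f(x) + f(y) - f(x+y)`. -/
def crossEffect {A B : Type*} [Add A] [AddCommGroup B] (f : A → B) (x y : A) : B :=
  f x + f y - f (x + y)

section Cohomology

variable (R : Type u) [Ring R] (B : Type v) [AddCommGroup B]

/-- Quadruples `(φ_·, φ_{·+}, φ_{+·}, φ_+)` of maps `R³ → B`, `R³ → B`, `R³ → B`, `R⁴ → B`, with
valuewise addition.  The arguments of `φ_+` are the entries `r₀₀ r₀₁ r₁₀ r₁₁` of a `2 × 2`
matrix. -/
abbrev Quadruple : Type (max u v) :=
  (R → R → R → B) × (R → R → R → B) × (R → R → R → B) × (R → R → R → R → B)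

variable {R B}

namespace Quadruple

/-- `φ_·` -/
def m (φ : Quadruple R B) : R → R → R → B := φ.1
/-- `φ_{·+}` -/
def l (φ : Quadruple R B) : R → R → R → B := φ.2.1
/-- `φ_{+·}` -/
def r (φ : Quadruple R B) : R → R → R → B := φ.2.2.1
/-- `φ_+` -/
def a (φ : Quadruple R B) : R → R → R → R → B := φ.2.2.2

@[simp] lemma add_m (φ ψ : Quadruple R B) (x y z : R) : (φ + ψ).m x y z = φ.m x y z + ψ.m x y z := rfl
@[simp] lemma add_l (φ ψ : Quadruple R B) (x y z : R) : (φ + ψ).l x y z = φ.l x y z + ψ.l x y z := rfl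
@[simp] lemma add_r (φ ψ : Quadruple R B) (x y z : R) : (φ + ψ).r x y z = φ.r x y z + ψ.r x y z := rfl
@[simp] lemma add_a (φ ψ : Quadruple R B) (x y z w : R) :
    (φ + ψ).a x y z w = φ.a x y z w + ψ.a x y z w := rfl
@[simp] lemma neg_m (φ : Quadruple R B) (x y z : R) : (-φ).m x y z = -φ.m x y z := rfl
@[simp] lemma neg_l (φ : Quadruple R B) (x y z : R) : (-φ).l x y z = -φ.l x y z := rfl
@[simp] lemma neg_r (φ : Quadruple R B) (x y z : R) : (-φ).r x y z = -φ.r x y z := rfl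
@[simp] lemma neg_a (φ : Quadruple R B) (x y z w : R) : (-φ).a x y z w = -φ.a x y z w := rfl

/-- Normalized quadruples. -/
structure IsNormalized (φ : Quadruple R B) : Prop where
  m₁ : ∀ s t, φ.m 0 s t = 0
  m₂ : ∀ r t, φ.m r 0 t = 0
  m₃ : ∀ r s, φ.m r s 0 = 0
  l₁ : ∀ s₀ s₁, φ.l 0 s₀ s₁ = 0
  l₂ : ∀ r s₁, φ.l r 0 s₁ = 0
  l₃ : ∀ r s₀, φ.l r s₀ 0 = 0
  r₁ : ∀ r₁ s, φ.r 0 r₁ s = 0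
  r₂ : ∀ r₀ s, φ.r r₀ 0 s = 0
  r₃ : ∀ r₀ r₁, φ.r r₀ r₁ 0 = 0
  a₁ : ∀ r₀ r₁, φ.a r₀ r₁ 0 0 = 0
  a₂ : ∀ r₀ r₁, φ.a 0 0 r₀ r₁ = 0
  a₃ : ∀ r₀ r₁, φ.a r₀ 0 r₁ 0 = 0
  a₄ : ∀ r₀ r₁, φ.a 0 r₀ 0 r₁ = 0
  a₅ : ∀ r₀ r₁, φ.a r₀ 0 0 r₁ = 0

variable [Module R B] [Module Rᵐᵒᵖ B]

/-- The eight cocycle equations.  `b <• t` is the right action of `t : R` on `b : B`. -/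
structure IsCocycle (φ : Quadruple R B) : Prop where
  eq₁ : ∀ r s t u, r • φ.m s t u - φ.m (r * s) t u + φ.m r (s * t) u - φ.m r s (t * u)
    + φ.m r s t <• u = 0
  eq₂ : ∀ r s t₀ t₁, r • φ.l s t₀ t₁ - φ.l (r * s) t₀ t₁ + φ.l r (s * t₀) (s * t₁) =
    crossEffect (fun t => φ.m r s t) t₀ t₁
  eq₃ : ∀ r s₀ s₁ t, φ.l r (s₀ * t) (s₁ * t) - φ.l r s₀ s₁ <• t =
    φ.r (r * s₀) (r * s₁) t - r • φ.r s₀ s₁ t + crossEffect (fun s => φ.m r s t) s₀ s₁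
  eq₄ : ∀ r₀ r₁ s t, φ.r (r₀ * s) (r₁ * s) t - φ.r r₀ r₁ (s * t) + φ.r r₀ r₁ s <• t =
    - crossEffect (fun r => φ.m r s t) r₀ r₁
  eq₅ : ∀ r s₀₀ s₀₁ s₁₀ s₁₁,
    φ.a (r * s₀₀) (r * s₀₁) (r * s₁₀) (r * s₁₁) - r • φ.a s₀₀ s₀₁ s₁₀ s₁₁ =
      crossEffect (fun p : R × R => φ.l r p.1 p.2) (s₀₀, s₁₀) (s₀₁, s₁₁)
      - crossEffect (fun p : R × R => φ.l r p.1 p.2) (s₀₀, s₀₁) (s₁₀, s₁₁)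
  eq₆ : ∀ r₀ r₁ s₀ s₁, φ.a (r₀ * s₀) (r₀ * s₁) (r₁ * s₀) (r₁ * s₁) =
    crossEffect (fun s => φ.r r₀ r₁ s) s₀ s₁ - crossEffect (fun r => φ.l r s₀ s₁) r₀ r₁
  eq₇ : ∀ r₀₀ r₀₁ r₁₀ r₁₁ s,
    φ.a (r₀₀ * s) (r₀₁ * s) (r₁₀ * s) (r₁₁ * s) - φ.a r₀₀ r₀₁ r₁₀ r₁₁ <• s =
      crossEffect (fun p : R × R => φ.r p.1 p.2 s) (r₀₀, r₁₀) (r₀₁, r₁₁)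
      - crossEffect (fun p : R × R => φ.r p.1 p.2 s) (r₀₀, r₀₁) (r₁₀, r₁₁)
  eq₈ : ∀ r₀₀₀ r₀₀₁ r₀₁₀ r₀₁₁ r₁₀₀ r₁₀₁ r₁₁₀ r₁₁₁,
    crossEffect (fun q : R × R × R × R => φ.a q.1 q.2.1 q.2.2.1 q.2.2.2)
        (r₀₀₀, r₀₀₁, r₀₁₀, r₀₁₁) (r₁₀₀, r₁₀₁, r₁₁₀, r₁₁₁)
      - crossEffect (fun q : R × R × R × R => φ.a q.1 q.2.1 q.2.2.1 q.2.2.2)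
        (r₀₀₀, r₀₀₁, r₁₀₀, r₁₀₁) (r₀₁₀, r₀₁₁, r₁₁₀, r₁₁₁)
      + crossEffect (fun q : R × R × R × R => φ.a q.1 q.2.1 q.2.2.1 q.2.2.2)
        (r₀₀₀, r₀₁₀, r₁₀₀, r₁₁₀) (r₀₀₁, r₀₁₁, r₁₀₁, r₁₁₁) = 0

/-- `φ` is the coboundary of the pair of maps `γ_· = γm`, `γ_+ = γa`. -/
structure IsCoboundaryOf (φ : Quadruple R B) (γm γa : R → R → B) : Prop where
  m : ∀ r s t, φ.m r s t = r • γm s t - γm (r * s) t + γm r (s * t) - γm r s <• t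
  l : ∀ r s₀ s₁, φ.l r s₀ s₁ = r • γa s₀ s₁ - γa (r * s₀) (r * s₁)
    + crossEffect (fun s => γm r s) s₀ s₁
  r : ∀ r₀ r₁ s, φ.r r₀ r₁ s = γa r₀ r₁ <• s - γa (r₀ * s) (r₁ * s)
    + crossEffect (fun r => γm r s) r₀ r₁
  a : ∀ r₀₀ r₀₁ r₁₀ r₁₁, φ.a r₀₀ r₀₁ r₁₀ r₁₁ =
    crossEffect (fun p : R × R => γa p.1 p.2) (r₀₀, r₀₁) (r₁₀, r₁₁)
    - crossEffect (fun p : R × R => γa p.1 p.2) (r₀₀, r₁₀) (r₀₁, r₁₁)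

end Quadruple

open Quadruple

variable (R B)

/-- The group of Mac Lane 3-cochains: normalized quadruples. -/
def C3 : AddSubgroup (Quadruple R B) where
  carrier := {φ | φ.IsNormalized}
  zero_mem' := by constructor <;> intros <;> rfl
  add_mem' := by
    intro φ ψ hφ hψ
    constructor <;> intros <;>
      simp [hφ.m₁, hφ.m₂, hφ.m₃, hφ.l₁, hφ.l₂, hφ.l₃, hφ.r₁, hφ.r₂, hφ.r₃, hφ.a₁, hφ.a₂, hφ.a₃,
        hφ.a₄, hφ.a₅, hψ.m₁, hψ.m₂, hψ.m₃, hψ.l₁, hψ.l₂, hψ.l₃, hψ.r₁, hψ.r₂, hψ.r₃, hψ.a₁,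
        hψ.a₂, hψ.a₃, hψ.a₄, hψ.a₅]
  neg_mem' := by
    intro φ hφ
    constructor <;> intros <;>
      simp [hφ.m₁, hφ.m₂, hφ.m₃, hφ.l₁, hφ.l₂, hφ.l₃, hφ.r₁, hφ.r₂, hφ.r₃, hφ.a₁, hφ.a₂, hφ.a₃,
        hφ.a₄, hφ.a₅]

variable [Module R B] [Module Rᵐᵒᵖ B]

/-- The subgroup of 3-cocycles. -/
def Z3 : AddSubgroup (C3 R B) where
  carrier := {φ | φ.1.IsCocycle}
  zero_mem' := by
    constructor <;> intros <;> simp [crossEffect, Quadruple.m, Quadruple.l, Quadruple.r, Quadruple.a]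
  add_mem' := by
    intro φ ψ hφ hψ
    constructor
    · intro r s t u
      convert congrArg₂ (· + ·) (hφ.eq₁ r s t u) (hψ.eq₁ r s t u) using 1 <;> simp <;> abel
    · intro r s t u
      convert congrArg₂ (· + ·) (hφ.eq₂ r s t u) (hψ.eq₂ r s t u) using 1 <;>
        simp [crossEffect] <;> abel
    · intro r s t u
      convert congrArg₂ (· + ·) (hφ.eq₃ r s t u) (hψ.eq₃ r s t u) using 1 <;>
        simp [crossEffect] <;> abel
    · intro r s t u
      convert congrArg₂ (· + ·) (hφ.eq₄ r s t u) (hψ.eq₄ r s t u) using 1 <;>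
        simp [crossEffect] <;> abel
    · intro r s t u w
      convert congrArg₂ (· + ·) (hφ.eq₅ r s t u w) (hψ.eq₅ r s t u w) using 1 <;>
        simp [crossEffect] <;> abel
    · intro r s t u
      convert congrArg₂ (· + ·) (hφ.eq₆ r s t u) (hψ.eq₆ r s t u) using 1 <;>
        simp [crossEffect] <;> abel
    · intro r s t u w
      convert congrArg₂ (· + ·) (hφ.eq₇ r s t u w) (hψ.eq₇ r s t u w) using 1 <;>
        simp [crossEffect] <;> abel
    · intro a b c d e f g h
      convert congrArg₂ (· + ·) (hφ.eq₈ a b c d e f g h) (hψ.eq₈ a b c d e f g h) using 1 <;>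
        simp [crossEffect] <;> abel
  neg_mem' := by
    intro φ hφ
    constructor
    · intro r s t u
      convert congrArg (- ·) (hφ.eq₁ r s t u) using 1 <;> simp <;> abel
    · intro r s t u
      convert congrArg (- ·) (hφ.eq₂ r s t u) using 1 <;> simp [crossEffect] <;> abel
    · intro r s t u
      convert congrArg (- ·) (hφ.eq₃ r s t u) using 1 <;> simp [crossEffect] <;> abel
    · intro r s t u
      convert congrArg (- ·) (hφ.eq₄ r s t u) using 1 <;> simp [crossEffect] <;> abel
    · intro r s t u w
      convert congrArg (- ·) (hφ.eq₅ r s t u w) using 1 <;> simp [crossEffect] <;> abel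
    · intro r s t u
      convert congrArg (- ·) (hφ.eq₆ r s t u) using 1 <;> simp [crossEffect] <;> abel
    · intro r s t u w
      convert congrArg (- ·) (hφ.eq₇ r s t u w) using 1 <;> simp [crossEffect] <;> abel
    · intro a b c d e f g h
      convert congrArg (- ·) (hφ.eq₈ a b c d e f g h) using 1 <;>
        simp [crossEffect] <;> abel

/-- The subgroup of 3-coboundaries. -/
def B3 : AddSubgroup (C3 R B) where
  carrier := {φ | ∃ γm γa : R → R → B, φ.1.IsCoboundaryOf γm γa}
  zero_mem' := ⟨0, 0, by
    constructor <;> intros <;> simp [crossEffect, Quadruple.m, Quadruple.l, Quadruple.r, Quadruple.a]⟩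
  add_mem' := by
    rintro φ ψ ⟨γm, γa, h⟩ ⟨γm', γa', h'⟩
    refine ⟨γm + γm', γa + γa', ?_⟩
    constructor <;> intros <;>
      simp [crossEffect, h.m, h.l, h.r, h.a, h'.m, h'.l, h'.r, h'.a] <;> abel
  neg_mem' := by
    rintro φ ⟨γm, γa, h⟩
    refine ⟨-γm, -γa, ?_⟩
    constructor <;> intros <;> simp [crossEffect, h.m, h.l, h.r, h.a] <;> abel

/-- Every coboundary is a cocycle. -/
theorem B3_le_Z3 [SMulCommClass R Rᵐᵒᵖ B] : B3 R B ≤ Z3 R B := by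
  rintro φ ⟨γm, γa, h⟩
  constructor <;> intros <;>
    simp only [crossEffect, h.m, h.l, h.r, h.a, smul_add, smul_sub, mul_smul, MulOpposite.op_mul,
      mul_add, add_mul, add_smul, MulOpposite.op_add, mul_assoc, smul_comm (_ : R) (_ : Rᵐᵒᵖ) (_ : B), Prod.mk_add_mk,
      add_add_add_comm] <;> abel_nf

/-- The third Mac Lane cohomology group. -/
abbrev H3 : Type (max u v) := Z3 R B ⧸ (B3 R B).addSubgroupOf (Z3 R B)

end Cohomology

/-! ### Categorical rings with prescribed `π₀` and `π₁` -/

section Crext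

variable (R : Type u) [Ring R] (B : Type v) [AddCommGroup B] [Module R B] [Module Rᵐᵒᵖ B]
  [SMulCommClass R Rᵐᵒᵖ B]

/-- A categorical ring `C` with `π₀(C) = R`, `π₁(C) = B`: the ring of isomorphism classes of objects
is identified with `R`, the group of automorphisms of the zero object is identified with `B`, and
the bimodule structure that `C` induces on its `π₁` is the given one.  There, the class of `x` acts
on `β : 0 ⟶ 0` by `xβ : x0 ⟶ x0` and the canonical isomorphism `x0 ⟶ 0`; since the group
of automorphisms of `0` is abelian, every isomorphism `e : x0 ⟶ 0` transports `xβ` to the same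
automorphism of `0`. -/
structure CrossedExtension where
  C : Type u
  [groupoid : Groupoid.{v} C]
  [monoidal : MonoidalCategory C]
  [symmetric : SymmetricCategory C]
  [mulStructure : MulStructure C]
  [categoricalRing : CategoricalRing C]
  pi0 : Quotient (isIsomorphicSetoid C) ≃ R
  pi0_add : ∀ x y : C, pi0 ⟦x ⊗ y⟧ = pi0 ⟦x⟧ + pi0 ⟦y⟧
  pi0_mul : ∀ x y : C, pi0 ⟦x ⊙ y⟧ = pi0 ⟦x⟧ * pi0 ⟦y⟧
  pi0_one : pi0 ⟦oneObj C⟧ = 1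
  pi1 : (𝟙_ C ⟶ 𝟙_ C) ≃ B
  pi1_comp : ∀ β β' : 𝟙_ C ⟶ 𝟙_ C, pi1 (β ≫ β') = pi1 β + pi1 β'
  pi1_smul : ∀ (x : C) (β : 𝟙_ C ⟶ 𝟙_ C) (e : x ⊙ 𝟙_ C ⟶ 𝟙_ C),
    pi1 (inv e ≫ (𝟙 x ⊙ₘ β) ≫ e) = pi0 ⟦x⟧ • pi1 β
  pi1_op_smul : ∀ (x : C) (β : 𝟙_ C ⟶ 𝟙_ C) (e : 𝟙_ C ⊙ x ⟶ 𝟙_ C),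
    pi1 (inv e ≫ (β ⊙ₘ 𝟙 x) ≫ e) = pi1 β <• pi0 ⟦x⟧

attribute [instance] CrossedExtension.groupoid CrossedExtension.monoidal
  CrossedExtension.symmetric CrossedExtension.mulStructure CrossedExtension.categoricalRing

variable {R B}

/-- There is a 2-homomorphism `X ⟶ Y` that induces the identity on `π₀ = R` and on `π₁ = B`. -/
def CrossedExtension.Rel (X Y : CrossedExtension R B) : Prop :=
  ∃ f : TwoHom X.C Y.C,
    (∀ x : X.C, Y.pi0 ⟦f.F.obj x⟧ = X.pi0 ⟦x⟧) ∧
    (∀ β : 𝟙_ X.C ⟶ 𝟙_ X.C,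
      Y.pi1 (f.addMonoidal.ε ≫ f.F.map β ≫ inv f.addMonoidal.ε) = X.pi1 β)

variable (R B) in
/-- Equivalence classes of categorical rings with `π₀ = R` and `π₁ = B`. -/
def Crext : Type (max (u + 1) (v + 1)) := Quot (CrossedExtension.Rel (R := R) (B := B))

namespace CrossedExtension

/-- The morphism `f + b : x ⟶ y` for `f : x ⟶ y` and `b ∈ π₁`; every morphism `x ⟶ y` is `f + b`
for a unique `b`, its difference from `f`. -/
def shift (X : CrossedExtension R B) {x y : X.C} (f : x ⟶ y) (b : B) : x ⟶ y :=
  (ρ_ x).inv ≫ (f ⊗ₘ X.pi1.symm b) ≫ (ρ_ y).hom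

/-- `φ` is the cochain measuring, for some choice of an object `obj r` in each isomorphism class
`r ∈ R` and of morphisms `σm r s : obj r * obj s ⟶ obj (r * s)` and
`σa r s : obj r + obj s ⟶ obj (r + s)`, how far these are from being compatible with the
constraints of the categorical ring. -/
def IsCharacteristic (X : CrossedExtension R B) (φ : Quadruple R B) : Prop :=
  ∃ (obj : R → X.C) (_ : ∀ r, X.pi0 ⟦obj r⟧ = r)
    (σm : ∀ r s : R, obj r ⊙ obj s ⟶ obj (r * s))
    (σa : ∀ r s : R, obj r ⊗ obj s ⟶ obj (r + s)),
    (∀ r s t : R,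
      (mulAssoc (obj r) (obj s) (obj t)).hom ≫ (𝟙 (obj r) ⊙ₘ σm s t) ≫ σm r (s * t) =
        X.shift ((σm r s ⊙ₘ 𝟙 (obj t)) ≫ σm (r * s) t ≫
          eqToHom (congrArg obj (mul_assoc r s t))) (φ.m r s t)) ∧
    (∀ r s₀ s₁ : R,
      ldis (obj r) (obj s₀) (obj s₁) ≫ (σm r s₀ ⊗ₘ σm r s₁) ≫ σa (r * s₀) (r * s₁) =
        X.shift ((𝟙 (obj r) ⊙ₘ σa s₀ s₁) ≫ σm r (s₀ + s₁) ≫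
          eqToHom (congrArg obj (mul_add r s₀ s₁))) (φ.l r s₀ s₁)) ∧
    (∀ r₀ r₁ s : R,
      rdis (obj r₀) (obj r₁) (obj s) ≫ (σm r₀ s ⊗ₘ σm r₁ s) ≫ σa (r₀ * s) (r₁ * s) =
        X.shift ((σa r₀ r₁ ⊙ₘ 𝟙 (obj s)) ≫ σm (r₀ + r₁) s ≫
          eqToHom (congrArg obj (add_mul r₀ r₁ s))) (φ.r r₀ r₁ s)) ∧
    (∀ r₀₀ r₀₁ r₁₀ r₁₁ : R,
      tensorμ (obj r₀₀) (obj r₀₁) (obj r₁₀) (obj r₁₁) ≫ (σa r₀₀ r₁₀ ⊗ₘ σa r₀₁ r₁₁) ≫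
          σa (r₀₀ + r₁₀) (r₀₁ + r₁₁) =
        X.shift ((σa r₀₀ r₀₁ ⊗ₘ σa r₁₀ r₁₁) ≫ σa (r₀₀ + r₀₁) (r₁₀ + r₁₁) ≫
          eqToHom (congrArg obj (add_add_add_comm r₀₀ r₀₁ r₁₀ r₁₁))) (φ.a r₀₀ r₀₁ r₁₀ r₁₁))

end CrossedExtension

end Crext

/-! ### The skeletal categorical ring of a cocycle -/

section Skeletal

variable {R : Type u} [Ring R] {B : Type v} [AddCommGroup B] [Module R B] [Module Rᵐᵒᵖ B]
  [SMulCommClass R Rᵐᵒᵖ B]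

/-- The type of objects of the skeletal categorical ring of `φ`: the elements of `R`. -/
@[nolint unusedArguments]
def Skel (_φ : Z3 R B) : Type u := R

/-- A morphism `(b, r) : r ⟶ s` where `s = r`. -/
@[ext]
structure SkelHom (φ : Z3 R B) (r s : Skel φ) : Type v where
  val : B
  eq : r = s

namespace Skel

variable {φ : Z3 R B}

/-- The element of `R` that an object is. -/
def el (r : Skel φ) : R := r

instance : Groupoid.{v} (Skel φ) where
  Hom r s := SkelHom φ r s
  id _ := ⟨0, rfl⟩
  comp f g := ⟨f.val + g.val, f.eq.trans g.eq⟩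
  inv f := ⟨-f.val, f.eq.symm⟩
  id_comp _ := SkelHom.ext (zero_add _)
  comp_id _ := SkelHom.ext (add_zero _)
  assoc _ _ _ := SkelHom.ext (add_assoc _ _ _)
  inv_comp _ := SkelHom.ext (neg_add_cancel _)
  comp_inv _ := SkelHom.ext (add_neg_cancel _)

/-- The morphism `(b, r) : r ⟶ s` for elements `r = s` of `R`. -/
def homMk {r s : Skel φ} (b : B) (h : r.el = s.el) : r ⟶ s := ⟨b, h⟩

@[ext] lemma hom_ext {r s : Skel φ} {f g : r ⟶ s} (h : f.val = g.val) : f = g := SkelHom.ext h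

@[simp] lemma homMk_val {r s : Skel φ} (b : B) (h : r.el = s.el) : (homMk b h).val = b := rfl
@[simp] lemma id_val (r : Skel φ) : SkelHom.val (𝟙 r) = 0 := rfl
@[simp] lemma comp_val {r s t : Skel φ} (f : r ⟶ s) (g : s ⟶ t) :
    SkelHom.val (f ≫ g) = f.val + g.val := rfl

lemma el_eq {r s : Skel φ} (f : r ⟶ s) : r.el = s.el := f.eq

/-- The isomorphism `(b, r) : r ⟶ s` for elements `r = s` of `R`. -/
def isoMk {r s : Skel φ} (b : B) (h : r.el = s.el) : r ≅ s where
  hom := homMk b h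
  inv := homMk (-b) h.symm

@[simp] lemma isoMk_hom_val {r s : Skel φ} (b : B) (h : r.el = s.el) :
    (isoMk b h).hom.val = b := rfl
@[simp] lemma isoMk_inv_val {r s : Skel φ} (b : B) (h : r.el = s.el) :
    (isoMk b h).inv.val = -b := rfl

/-- The additive monoidal structure: addition of elements of `R`,
`(b₀, r₀) + (b₁, r₁) = (b₀ + b₁, r₀ + r₁)`. -/
instance : MonoidalCategoryStruct (Skel φ) where
  tensorObj r s := (r.el + s.el : R)
  whiskerLeft r _ _ f := homMk f.val (congrArg (fun x : R => r.el + x) (el_eq f))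
  whiskerRight f r := homMk f.val (congrArg (fun x : R => x + r.el) (el_eq f))
  tensorHom f g := homMk (f.val + g.val) (congrArg₂ (· + ·) (el_eq f) (el_eq g))
  tensorUnit := (0 : R)
  associator r s t := isoMk (φ.1.1.a r.el s.el 0 t.el) (add_assoc r.el s.el t.el)
  leftUnitor r := isoMk 0 (zero_add r.el)
  rightUnitor r := isoMk 0 (add_zero r.el)

@[simp] lemma el_add (r s : Skel φ) : (r ⊗ s).el = r.el + s.el := rfl
@[simp] lemma el_zero : (𝟙_ (Skel φ)).el = 0 := rfl
@[simp] lemma whiskerLeft_val (r : Skel φ) {s t : Skel φ} (f : s ⟶ t) : (r ◁ f).val = f.val := rfl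
@[simp] lemma whiskerRight_val (r : Skel φ) {s t : Skel φ} (f : s ⟶ t) : (f ▷ r).val = f.val := rfl
@[simp] lemma tensorHom_val {r r' s s' : Skel φ} (f : r ⟶ r') (g : s ⟶ s') :
    (f ⊗ₘ g).val = f.val + g.val := rfl
@[simp] lemma associator_hom_val (r s t : Skel φ) :
    (α_ r s t).hom.val = φ.1.1.a r.el s.el 0 t.el := rfl
@[simp] lemma associator_inv_val (r s t : Skel φ) :
    (α_ r s t).inv.val = - φ.1.1.a r.el s.el 0 t.el := rfl
@[simp] lemma leftUnitor_hom_val (r : Skel φ) : (λ_ r).hom.val = 0 := rfl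
@[simp] lemma rightUnitor_hom_val (r : Skel φ) : (ρ_ r).hom.val = 0 := rfl

instance : MonoidalCategory (Skel φ) where
  tensorHom_def f g := by ext; simp
  id_tensorHom_id _ _ := by ext; simp
  tensorHom_comp_tensorHom _ _ _ _ := by ext; simp; abel
  whiskerLeft_id _ _ := rfl
  id_whiskerRight _ _ := rfl
  associator_naturality f g h := by
    ext; simp [el_eq f, el_eq g, el_eq h]; abel
  leftUnitor_naturality f := by ext; simp
  rightUnitor_naturality f := by ext; simp
  pentagon w x y z := by
    ext
    have h := φ.2.eq₈ w.el x.el 0 y.el 0 0 0 z.el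
    simp [crossEffect, φ.1.2.a₁, φ.1.2.a₂, φ.1.2.a₃, φ.1.2.a₄, φ.1.2.a₅] at h
    simp
    linear_combination (norm := abel) h
  triangle x y := by
    ext; simp [φ.1.2.a₅]

/-- The symmetry constraint. -/
def symm (r s : Skel φ) : r ⊗ s ≅ s ⊗ r := isoMk (φ.1.1.a 0 r.el s.el 0) (add_comm r.el s.el)

@[simp] lemma symm_hom_val (r s : Skel φ) : (symm r s).hom.val = φ.1.1.a 0 r.el s.el 0 := rfl

instance : SymmetricCategory (Skel φ) where
  braiding := symm
  braiding_naturality_right x _ _ f := by ext; simp [el_eq f]; abel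
  braiding_naturality_left f x := by ext; simp [el_eq f]; abel
  hexagon_forward x y z := by
    ext
    have h := φ.2.eq₈ 0 x.el y.el 0 0 0 0 z.el
    have h' := φ.2.eq₈ 0 0 0 x.el y.el z.el 0 0
    simp [crossEffect, φ.1.2.a₁, φ.1.2.a₂, φ.1.2.a₃, φ.1.2.a₄, φ.1.2.a₅] at h h'
    simp
    linear_combination (norm := abel) -h - h'
  hexagon_reverse x y z := by
    ext
    have h := φ.2.eq₈ 0 x.el 0 y.el 0 0 z.el 0
    have h' := φ.2.eq₈ 0 x.el z.el 0 0 0 0 y.el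
    simp [crossEffect, φ.1.2.a₁, φ.1.2.a₂, φ.1.2.a₃, φ.1.2.a₄, φ.1.2.a₅] at h h'
    simp
    linear_combination (norm := abel) h - h'
  symmetry x y := by
    ext
    have h := φ.2.eq₈ 0 0 x.el 0 0 y.el 0 0
    simp [crossEffect, φ.1.2.a₁, φ.1.2.a₂, φ.1.2.a₃, φ.1.2.a₄, φ.1.2.a₅] at h
    simp
    linear_combination (norm := abel) -h

@[simp] lemma braiding_hom_val (r s : Skel φ) :
    (β_ r s).hom.val = φ.1.1.a 0 r.el s.el 0 := rfl

@[simp] lemma tensorμ_val (w x y z : Skel φ) :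
    (tensorμ w x y z).val = φ.1.1.a w.el x.el y.el z.el := by
  have h₁ := φ.2.eq₈ 0 x.el y.el 0 w.el 0 0 z.el
  have h₂ := φ.2.eq₈ 0 x.el 0 y.el w.el 0 0 z.el
  have h₃ := φ.2.eq₈ 0 y.el 0 x.el w.el 0 0 z.el
  simp [crossEffect, φ.1.2.a₁, φ.1.2.a₂, φ.1.2.a₃, φ.1.2.a₄, φ.1.2.a₅] at h₁ h₂ h₃
  simp [tensorμ]
  linear_combination (norm := abel_nf) h₁ - h₂ + h₃

/-- The multiplicative monoidal structure: multiplication of elements of `R`,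
`(b, r)(b', r') = (br' + rb', rr')`. -/
@[reducible] def mulStruct (φ : Z3 R B) : MonoidalCategoryStruct (Skel φ) where
  tensorObj r s := (r.el * s.el : R)
  whiskerLeft r _ _ f := homMk (r.el • f.val) (congrArg (fun x : R => r.el * x) (el_eq f))
  whiskerRight f r := homMk (f.val <• r.el) (congrArg (fun x : R => x * r.el) (el_eq f))
  tensorHom {r _ s _} f g :=
    homMk (f.val <• s.el + r.el • g.val) (congrArg₂ (fun x y : R => x * y) (el_eq f) (el_eq g))
  tensorUnit := (1 : R)
  associator r s t := isoMk (φ.1.1.m r.el s.el t.el) (mul_assoc r.el s.el t.el)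
  leftUnitor r := isoMk (-φ.1.1.m 1 1 r.el) (one_mul r.el)
  rightUnitor r := isoMk (φ.1.1.m r.el 1 1) (mul_one r.el)

/-- The multiplicative monoidal structure. -/
@[reducible] def mulMon (φ : Z3 R B) : MonoidalCategory (Skel φ) where
  __ := mulStruct φ
  tensorHom_def {r r' s s'} f g := by
    apply hom_ext
    change f.val <• s.el + r.el • g.val = f.val <• s.el + r'.el • g.val
    rw [el_eq f]
  id_tensorHom_id r s := by
    apply hom_ext
    change (0 : B) <• s.el + r.el • (0 : B) = 0
    simp
  tensorHom_comp_tensorHom {r r' r'' s s' s''} f g f' g' := by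
    apply hom_ext
    change (f.val <• s.el + r.el • g.val) + (f'.val <• s'.el + r'.el • g'.val) =
      (f.val + f'.val) <• s.el + r.el • (g.val + g'.val)
    rw [el_eq f, el_eq g, smul_add, smul_add]
    abel
  whiskerLeft_id r s := by
    apply hom_ext
    change r.el • (0 : B) = 0
    simp
  id_whiskerRight r s := by
    apply hom_ext
    change (0 : B) <• s.el = 0
    simp
  associator_naturality {r s t r' s' t'} f g h := by
    apply hom_ext
    change (f.val <• s.el + r.el • g.val) <• t.el + (r.el * s.el) • h.val +
        φ.1.1.m r'.el s'.el t'.el =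
      φ.1.1.m r.el s.el t.el +
        (f.val <• (s.el * t.el) + r.el • (g.val <• t.el + s.el • h.val))
    rw [el_eq f, el_eq g, el_eq h, smul_add, smul_add, mul_smul, MulOpposite.op_mul, mul_smul,
      smul_comm r'.el (MulOpposite.op t'.el)]
    abel
  leftUnitor_naturality {r s} f := by
    apply hom_ext
    change (1 : R) • f.val + -φ.1.1.m 1 1 s.el = -φ.1.1.m 1 1 r.el + f.val
    rw [el_eq f, one_smul]
    abel
  rightUnitor_naturality {r s} f := by
    apply hom_ext
    change f.val <• (1 : R) + φ.1.1.m s.el 1 1 = φ.1.1.m r.el 1 1 + f.val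
    rw [el_eq f, MulOpposite.op_one, one_smul]
    abel
  pentagon r s t w := by
    apply hom_ext
    change φ.1.1.m r.el s.el t.el <• w.el + (φ.1.1.m r.el (s.el * t.el) w.el +
        r.el • φ.1.1.m s.el t.el w.el) =
      φ.1.1.m (r.el * s.el) t.el w.el + φ.1.1.m r.el s.el (t.el * w.el)
    linear_combination (norm := abel) φ.2.eq₁ r.el s.el t.el w.el
  triangle r s := by
    apply hom_ext
    change φ.1.1.m r.el 1 s.el + r.el • (-φ.1.1.m 1 1 s.el) = φ.1.1.m r.el 1 1 <• s.el
    have h := φ.2.eq₁ r.el 1 1 s.el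
    rw [mul_one, mul_one, one_mul] at h
    rw [smul_neg]
    linear_combination (norm := abel) -h

instance : MulStructure (Skel φ) where
  mon := mulMon φ

@[simp] lemma el_mul (r s : Skel φ) : (r ⊙ s).el = r.el * s.el := rfl
@[simp] lemma el_one : (oneObj (Skel φ)).el = 1 := rfl
@[simp] lemma mulHom_val {r r' s s' : Skel φ} (f : r ⟶ r') (g : s ⟶ s') :
    (f ⊙ₘ g).val = f.val <• s.el + r.el • g.val := rfl
@[simp] lemma mulAssoc_hom_val (r s t : Skel φ) :
    (mulAssoc r s t).hom.val = φ.1.1.m r.el s.el t.el := rfl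
@[simp] lemma oneMul_hom_val (r : Skel φ) : (oneMul r).hom.val = -φ.1.1.m 1 1 r.el := rfl
@[simp] lemma mulOne_hom_val (r : Skel φ) : (mulOne r).hom.val = φ.1.1.m r.el 1 1 := rfl

/-- The left distributivity constraint. -/
def ldisHom (r s₀ s₁ : Skel φ) : r ⊙ (s₀ ⊗ s₁) ⟶ (r ⊙ s₀) ⊗ (r ⊙ s₁) :=
  homMk (φ.1.1.l r.el s₀.el s₁.el) (mul_add r.el s₀.el s₁.el)

/-- The right distributivity constraint. -/
def rdisHom (r₀ r₁ s : Skel φ) : (r₀ ⊗ r₁) ⊙ s ⟶ (r₀ ⊙ s) ⊗ (r₁ ⊙ s) :=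
  homMk (φ.1.1.r r₀.el r₁.el s.el) (add_mul r₀.el r₁.el s.el)

@[simp] lemma ldisHom_val (r s₀ s₁ : Skel φ) :
    (ldisHom r s₀ s₁).val = φ.1.1.l r.el s₀.el s₁.el := rfl
@[simp] lemma rdisHom_val (r₀ r₁ s : Skel φ) :
    (rdisHom r₀ r₁ s).val = φ.1.1.r r₀.el r₁.el s.el := rfl

instance : CategoricalRing (Skel φ) where
  neg r := (-r.el : R)
  negHom r := homMk 0 (neg_add_cancel r.el)
  ldis := ldisHom
  rdis := rdisHom
  ldis_natural f g₀ g₁ := by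
    ext; simp [el_eq f, el_eq g₀, el_eq g₁, add_smul]; abel
  rdis_natural f₀ f₁ g := by
    ext; simp [el_eq f₀, el_eq f₁, el_eq g, add_smul]; abel
  ldis_assoc r s t₀ t₁ := by
    ext
    have h := φ.2.eq₂ r.el s.el t₀.el t₁.el
    simp [crossEffect] at h ⊢
    linear_combination (norm := abel) h
  ldis_rdis_assoc r s₀ s₁ t := by
    ext
    have h := φ.2.eq₃ r.el s₀.el s₁.el t.el
    simp [crossEffect] at h ⊢
    linear_combination (norm := abel) -h
  rdis_assoc r₀ r₁ s t := by
    ext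
    have h := φ.2.eq₄ r₀.el r₁.el s.el t.el
    simp [crossEffect] at h ⊢
    linear_combination (norm := abel) h
  ldis_one r₀ r₁ := by
    ext
    have h := φ.2.eq₂ 1 1 r₀.el r₁.el
    simp [crossEffect] at h ⊢
    linear_combination (norm := abel) h
  rdis_one r₀ r₁ := by
    ext
    have h := φ.2.eq₄ r₀.el r₁.el 1 1
    simp [crossEffect] at h ⊢
    linear_combination (norm := abel) h
  ldis_interchange r a b c d := by
    ext
    have h := φ.2.eq₅ r.el a.el b.el c.el d.el
    simp [crossEffect] at h ⊢
    linear_combination (norm := abel) h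
  rdis_ldis_interchange a b c d := by
    ext
    have h := φ.2.eq₆ a.el b.el c.el d.el
    simp [crossEffect] at h ⊢
    linear_combination (norm := abel) h
  rdis_interchange a b c d r := by
    ext
    have h := φ.2.eq₇ a.el b.el c.el d.el r.el
    simp [crossEffect] at h ⊢
    linear_combination (norm := abel) h
  ldis_add_assoc r a b c := by
    ext
    have h := φ.2.eq₅ r.el a.el b.el 0 c.el
    simp [crossEffect, φ.1.2.l₂, φ.1.2.l₃] at h ⊢
    linear_combination (norm := abel) h
  rdis_add_assoc a b c r := by
    ext
    have h := φ.2.eq₇ a.el b.el 0 c.el r.el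
    simp [crossEffect, φ.1.2.r₁, φ.1.2.r₂] at h ⊢
    linear_combination (norm := abel) h

end Skel

/-- The skeletal categorical ring of a 3-cocycle `φ`: its objects are the elements of `R`, its
morphisms are the automorphisms `(b, r) : r ⟶ r` for `b ∈ B`, and its constraints are given by `φ`. -/
def skeletal (φ : Z3 R B) : CrossedExtension R B where
  C := Skel φ
  pi0 :=
    { toFun := Quotient.lift Skel.el (fun _ _ h => h.elim fun i => Skel.el_eq i.hom)
      invFun := fun r => Quotient.mk _ (show Skel φ from r)
      left_inv := fun q => by induction q using Quotient.inductionOn; rfl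
      right_inv := fun _ => rfl }
  pi0_add _ _ := rfl
  pi0_mul _ _ := rfl
  pi0_one := rfl
  pi1 :=
    { toFun := fun f => f.val
      invFun := fun b => Skel.homMk b rfl
      left_inv := fun _ => rfl
      right_inv := fun _ => rfl }
  pi1_comp _ _ := rfl
  pi1_smul x β e := by
    have h : (inv e).val = -e.val := by
      rw [← Groupoid.inv_eq_inv]; rfl
    change (inv e).val + ((0 : B) <• (0 : R) + x.el • β.val + e.val) = x.el • β.val
    rw [h, smul_zero]; abel
  pi1_op_smul x β e := by
    have h : (inv e).val = -e.val := by
      rw [← Groupoid.inv_eq_inv]; rfl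
    change (inv e).val + (β.val <• x.el + (0 : R) • (0 : B) + e.val) = β.val <• x.el
    rw [h, smul_zero]; abel

end Skeletal

/-! Every morphism set of a categorical ring with `π₁ = B` is empty or a torsor under `B`, with
shifts `aut` that are central and behave under addition and multiplication as in a bimodule
(`comp_aut_tensorHom_comp_aut`, `comp_aut_mulHom_comp_aut`). Trivializing all these torsors at once
gives a `Valuation`: morphisms get values in `B`, additive under composition, while sum and product
are respected up to corrections `κ` and `ν` depending on the objects. Morphisms of equal value
between the same objects are equal (`val_injective`), so commuting diagrams are the same as additive
identities in `B`.

The value of a structural constraint, corrected by `κ` and `ν`, depends only on the classes of its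
objects, by naturality. So a valuation yields a quadruple of functions on `R`, its `cochain`.
Equations 1 to 7 are the coherence axioms read through the valuation; equation 8 says that addition,
as a functor of two variables, respects interchange (`interchange_cube`). The cochains of valuations
are exactly the characteristic cochains (`isCharacteristic_cochain`, `exists_cochain_eq`). Changing
`κ` and `ν` by functions of the classes adds an arbitrary coboundary (`isCoboundaryOf_modify`,
`modify_cochain_eq`), and some choice makes the cochain normalized (`exists_isNormalized`).

Two facts turn the relation `Rel` into a comparison of cochains. A 2-homomorphism that is the
identity on `π₀` and `π₁` pulls valuations back without changing the cochain (`cochain_pullback`);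
it is not assumed to respect the symmetry, but distributivity forces this. Conversely, valuations of
`X` and `Y` with the same normalized cochain give a 2-homomorphism, namely the value-preserving
functor with structure morphisms of values `V.κ - W.κ` and `V.ν - W.ν` (`rel_of_cochain_eq`). The
delicate point is units: a cochain does not record the unit constraints, so they are first made
constant (`exists_unital`), after which associativity can be read off from `φ_+`.

So `Rel` is an equivalence relation. The skeletal ring of `φ` has a valuation with cochain `φ`, and
all its valuations have cochains cohomologous to `φ`; this gives injectivity (`rel_skeletal_iff`).
Surjectivity and the description of the inverse follow by comparing `X` with the skeletal ring of
one of its normalized cochains. -/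

/-! ### Categorical groups -/

section CategoricalGroup

variable {C : Type u} [Groupoid.{v} C] [MonoidalCategory C] [CategoricalGroup C]

open CategoricalGroup

/-- Addition of an object of a categorical group is faithful. -/
theorem whiskerLeft_injective (x : C) {y z : C} {f g : y ⟶ z} (h : x ◁ f = x ◁ g) : f = g := by
  -- Adding `neg x` and cancelling `neg x ⊗ x` recovers `k` from `x ◁ k`.
  have key : ∀ k : y ⟶ z, k = (λ_ y).inv ≫ inv (negHom x) ▷ y ≫ (α_ (neg x) x y).hom ≫
      neg x ◁ (x ◁ k) ≫ (α_ (neg x) x z).inv ≫ negHom x ▷ z ≫ (λ_ z).hom := fun k => by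
    have h₁ : (α_ (neg x) x y).hom ≫ neg x ◁ x ◁ k ≫ (α_ (neg x) x z).inv ≫ negHom x ▷ z ≫
        (λ_ z).hom = (neg x ⊗ x) ◁ k ≫ negHom x ▷ z ≫ (λ_ z).hom := by simp
    rw [h₁, whisker_exchange_assoc, ← comp_whiskerRight_assoc, IsIso.inv_hom_id]
    simp
  rw [key f, key g, h]

/-- Every automorphism of `x ⊗ 𝟙_ C` is the sum of the identity of `x` and an automorphism of
`𝟙_ C`. -/
theorem exists_whiskerLeft_eq (x : C) (h : x ⟶ x) :
    ∃ β : 𝟙_ C ⟶ 𝟙_ C, x ◁ β = (ρ_ x).hom ≫ h ≫ (ρ_ x).inv := by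
  -- The candidate is `h` translated to `𝟙_ C` by adding `neg x`. As this translation is faithful,
  -- the equation may be checked after adding `neg x` once more, where both sides are conjugates of
  -- `neg x ◁ h`.
  refine ⟨inv (negHom x) ≫ neg x ◁ h ≫ negHom x, whiskerLeft_injective (neg x) ?_⟩
  have e₁ : ∀ β : 𝟙_ C ⟶ 𝟙_ C, neg x ◁ x ◁ β = (α_ (neg x) x (𝟙_ C)).inv ≫
      (ρ_ (neg x ⊗ x)).hom ≫ negHom x ≫ β ≫ inv (negHom x) ≫ (ρ_ (neg x ⊗ x)).inv ≫
        (α_ (neg x) x (𝟙_ C)).hom := fun β => by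
    have e₂ : (neg x ⊗ x) ◁ β = (ρ_ (neg x ⊗ x)).hom ≫ negHom x ≫ β ≫ inv (negHom x) ≫
        (ρ_ (neg x ⊗ x)).inv := by
      have e₃ : 𝟙_ C ◁ β = (ρ_ (𝟙_ C)).hom ≫ β ≫ (ρ_ (𝟙_ C)).inv := by
        rw [← unitors_equal, ← unitors_inv_equal, id_whiskerLeft]
      have e₄ : (neg x ⊗ x) ◁ β = negHom x ▷ _ ≫ 𝟙_ C ◁ β ≫ inv (negHom x) ▷ _ := by
        rw [← whisker_exchange_assoc, ← comp_whiskerRight, IsIso.hom_inv_id, id_whiskerRight,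
          Category.comp_id]
      rw [e₄, e₃]
      simp
    rw [← cancel_epi (α_ (neg x) x (𝟙_ C)).hom, ← cancel_mono (α_ (neg x) x (𝟙_ C)).inv]
    simpa using e₂
  rw [e₁]
  simp

end CategoricalGroup

/-! ### Multiplication of a categorical ring -/

section MulStructure

variable {C : Type u} [Category.{v} C] [MulStructure C]

theorem id_mulHom_id (r s : C) : (𝟙 r ⊙ₘ 𝟙 s) = 𝟙 (r ⊙ s) :=
  let _ := MulStructure.mon (C := C); MonoidalCategory.id_tensorHom_id r s

theorem mulHom_comp_mulHom {r r' r'' s s' s'' : C} (f : r ⟶ r') (g : s ⟶ s') (f' : r' ⟶ r'')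
    (g' : s' ⟶ s'') : (f ⊙ₘ g) ≫ (f' ⊙ₘ g') = (f ≫ f') ⊙ₘ (g ≫ g') :=
  let _ := MulStructure.mon (C := C); MonoidalCategory.tensorHom_comp_tensorHom f g f' g'

theorem mulAssoc_natural {r r' s s' t t' : C} (f : r ⟶ r') (g : s ⟶ s') (h : t ⟶ t') :
    ((f ⊙ₘ g) ⊙ₘ h) ≫ (mulAssoc r' s' t').hom = (mulAssoc r s t).hom ≫ (f ⊙ₘ g ⊙ₘ h) :=
  let _ := MulStructure.mon (C := C); MonoidalCategory.associator_naturality f g h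

theorem oneMul_natural {r s : C} (f : r ⟶ s) :
    (𝟙 (oneObj C) ⊙ₘ f) ≫ (oneMul s).hom = (oneMul r).hom ≫ f := by
  let _ := MulStructure.mon (C := C)
  exact (congrArg (· ≫ _) (MonoidalCategory.id_tensorHom _ f)).trans
    (MonoidalCategory.leftUnitor_naturality f)

theorem mulOne_natural {r s : C} (f : r ⟶ s) :
    (f ⊙ₘ 𝟙 (oneObj C)) ≫ (mulOne s).hom = (mulOne r).hom ≫ f := by
  let _ := MulStructure.mon (C := C)
  exact (congrArg (· ≫ _) (MonoidalCategory.tensorHom_id f _)).trans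
    (MonoidalCategory.rightUnitor_naturality f)

theorem mul_pentagon (r s t w : C) :
    ((mulAssoc r s t).hom ⊙ₘ 𝟙 w) ≫ (mulAssoc r (s ⊙ t) w).hom ≫ (𝟙 r ⊙ₘ (mulAssoc s t w).hom) =
      (mulAssoc (r ⊙ s) t w).hom ≫ (mulAssoc r s (t ⊙ w)).hom := by
  let _ := MulStructure.mon (C := C)
  have h := MonoidalCategory.pentagon r s t w
  rw [← MonoidalCategory.tensorHom_id, ← MonoidalCategory.id_tensorHom] at h
  exact h

theorem mul_triangle (r s : C) :
    (mulAssoc r (oneObj C) s).hom ≫ (𝟙 r ⊙ₘ (oneMul s).hom) = ((mulOne r).hom ⊙ₘ 𝟙 s) := by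
  let _ := MulStructure.mon (C := C)
  have h := MonoidalCategory.triangle r s
  rw [← MonoidalCategory.tensorHom_id, ← MonoidalCategory.id_tensorHom] at h
  exact h

theorem oneMul_one : (oneMul (oneObj C)).hom = (mulOne (oneObj C)).hom :=
  let _ := MulStructure.mon (C := C); MonoidalCategory.unitors_equal

end MulStructure

/-! ### The action of `π₁` on morphisms -/

namespace CrossedExtension

variable {R : Type u} [Ring R] {B : Type v} [AddCommGroup B] [Module R B] [Module Rᵐᵒᵖ B]
  [SMulCommClass R Rᵐᵒᵖ B] (X : CrossedExtension R B)

/-- The class of an object in `π₀ = R`. -/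
def cls (x : X.C) : R := X.pi0 ⟦x⟧

theorem cls_tensor (x y : X.C) : X.cls (x ⊗ y) = X.cls x + X.cls y := X.pi0_add x y

theorem cls_mul (x y : X.C) : X.cls (x ⊙ y) = X.cls x * X.cls y := X.pi0_mul x y

theorem cls_one : X.cls (oneObj X.C) = 1 := X.pi0_one

theorem cls_eq {x y : X.C} (f : x ⟶ y) : X.cls x = X.cls y :=
  congrArg X.pi0 (Quotient.sound ⟨asIso f⟩)

/-- Since `0 + 0 ≅ 0`, the class is idempotent for the addition of `R`. -/
theorem cls_unit : X.cls (𝟙_ X.C) = 0 := by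
  have h := X.cls_eq (λ_ (𝟙_ X.C)).hom
  rw [cls_tensor] at h
  simpa using h

theorem exists_hom {x y : X.C} (h : X.cls x = X.cls y) : Nonempty (x ⟶ y) :=
  (Quotient.exact (X.pi0.injective h)).elim fun i => ⟨i.hom⟩

theorem exists_cls (r : R) : ∃ x, X.cls x = r := by
  obtain ⟨q, hq⟩ := X.pi0.surjective r
  induction q using Quotient.inductionOn with | _ x => exact ⟨x, hq⟩

theorem pi1_symm_add (b c : B) : X.pi1.symm (b + c) = X.pi1.symm b ≫ X.pi1.symm c := by
  apply X.pi1.injective; simp [X.pi1_comp]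

theorem pi1_id : X.pi1 (𝟙 _) = 0 := by
  have h := X.pi1_comp (𝟙 _) (𝟙 _)
  simpa using h

theorem pi1_symm_zero : X.pi1.symm 0 = 𝟙 _ := by
  apply X.pi1.injective; simp [X.pi1_id]

/-- The automorphism `1 + b` of an object. -/
def aut (x : X.C) (b : B) : x ⟶ x := (ρ_ x).inv ≫ x ◁ X.pi1.symm b ≫ (ρ_ x).hom

theorem rightUnitor_aut (x : X.C) (b : B) :
    (ρ_ x).hom ≫ X.aut x b = x ◁ X.pi1.symm b ≫ (ρ_ x).hom := by
  simp [aut]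

/-- The exchange law for `f` acting on the left summand and `b` on the right one: the shifts are
central in the groupoid. -/
theorem comp_aut {x y : X.C} (f : x ⟶ y) (b : B) : f ≫ X.aut y b = X.aut x b ≫ f := by
  simp only [aut, Category.assoc]
  rw [rightUnitor_inv_naturality_assoc, ← whisker_exchange_assoc, rightUnitor_naturality]

theorem shift_eq {x y : X.C} (f : x ⟶ y) (b : B) : X.shift f b = f ≫ X.aut y b := by
  simp only [shift, aut, MonoidalCategory.tensorHom_def, Category.assoc]
  rw [rightUnitor_inv_naturality_assoc]

theorem aut_add (x : X.C) (b c : B) : X.aut x (b + c) = X.aut x b ≫ X.aut x c := by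
  simp [aut, pi1_symm_add]

theorem aut_zero (x : X.C) : X.aut x 0 = 𝟙 x := by
  simp [aut, pi1_symm_zero]

theorem aut_unit (b : B) : X.aut (𝟙_ X.C) b = X.pi1.symm b := by
  rw [aut, ← unitors_equal, ← unitors_inv_equal, id_whiskerLeft]
  simp

theorem aut_injective (x : X.C) : Function.Injective (X.aut x) := fun b c h => by
  apply X.pi1.symm.injective
  apply whiskerLeft_injective x
  rw [← cancel_mono (ρ_ x).hom, ← rightUnitor_aut, ← rightUnitor_aut, h]

theorem exists_aut_eq {x : X.C} (h : x ⟶ x) : ∃ b, X.aut x b = h := by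
  obtain ⟨β, hβ⟩ := exists_whiskerLeft_eq x h
  refine ⟨X.pi1 β, ?_⟩
  rw [← cancel_epi (ρ_ x).hom, rightUnitor_aut, Equiv.symm_apply_apply, hβ]
  simp

/-- Together with `comp_aut_injective`: a nonempty morphism set is a torsor under `B`. -/
theorem exists_eq_comp_aut {x y : X.C} (f g : x ⟶ y) : ∃ b, g = f ≫ X.aut y b := by
  obtain ⟨b, hb⟩ := X.exists_aut_eq (inv f ≫ g)
  exact ⟨b, by rw [hb]; simp⟩

theorem comp_aut_injective {x y : X.C} (f : x ⟶ y) {b c : B} (h : f ≫ X.aut y b = f ≫ X.aut y c) :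
    b = c :=
  X.aut_injective y ((cancel_epi f).1 h)

theorem whiskerLeft_aut (x y : X.C) (b : B) : x ◁ X.aut y b = X.aut (x ⊗ y) b := by
  simp [aut]

/-- `aut` is defined by adding on the right, so addition of `y` on this side is reached through the
braiding, past which shifts move by centrality. -/
theorem aut_whiskerRight (x y : X.C) (b : B) : X.aut x b ▷ y = X.aut (x ⊗ y) b := by
  have h : X.aut x b ▷ y = (β_ x y).hom ≫ y ◁ X.aut x b ≫ (β_ x y).inv := by simp
  rw [h, whiskerLeft_aut, ← comp_aut]
  simp

/-- Any isomorphism `x0 ⟶ 0` satisfies the equation up to a shift `b`, which is then absorbed into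
`e`. Letting `e` depend on `y` is harmless, since `pi1_smul` holds for every `e`. -/
theorem exists_mul_unit (x y : X.C) : ∃ e : x ⊙ 𝟙_ X.C ⟶ 𝟙_ X.C,
    ldis x y (𝟙_ X.C) ≫ (x ⊙ y) ◁ e ≫ (ρ_ _).hom = (𝟙 x ⊙ₘ (ρ_ y).hom) := by
  obtain ⟨e⟩ := X.exists_hom (x := x ⊙ 𝟙_ X.C) (y := 𝟙_ X.C) (by rw [cls_mul, cls_unit, mul_zero])
  obtain ⟨b, hb⟩ := X.exists_eq_comp_aut (ldis x y (𝟙_ X.C) ≫ (x ⊙ y) ◁ e ≫ (ρ_ _).hom)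
    (𝟙 x ⊙ₘ (ρ_ y).hom)
  refine ⟨e ≫ X.pi1.symm b, ?_⟩
  rw [hb]
  simp [rightUnitor_aut]

theorem exists_unit_mul (x y : X.C) : ∃ e : 𝟙_ X.C ⊙ y ⟶ 𝟙_ X.C,
    rdis x (𝟙_ X.C) y ≫ (x ⊙ y) ◁ e ≫ (ρ_ _).hom = ((ρ_ x).hom ⊙ₘ 𝟙 y) := by
  obtain ⟨e⟩ := X.exists_hom (x := 𝟙_ X.C ⊙ y) (y := 𝟙_ X.C) (by rw [cls_mul, cls_unit, zero_mul])
  obtain ⟨b, hb⟩ := X.exists_eq_comp_aut (rdis x (𝟙_ X.C) y ≫ (x ⊙ y) ◁ e ≫ (ρ_ _).hom)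
    ((ρ_ x).hom ⊙ₘ 𝟙 y)
  refine ⟨e ≫ X.pi1.symm b, ?_⟩
  rw [hb]
  simp [rightUnitor_aut]

/-- By left distributivity, multiplying `y + β` by `x` is adding `xβ` to `x ⊙ y`. The `e` of
`exists_mul_unit` moves `xβ` to an automorphism of `0`, which `pi1_smul` identifies as the action of
the class of `x`. -/
theorem id_mulHom_aut (x y : X.C) (b : B) : (𝟙 x ⊙ₘ X.aut y b) = X.aut (x ⊙ y) (X.cls x • b) := by
  obtain ⟨e, he⟩ := X.exists_mul_unit x y
  have h₁ : (𝟙 x ⊙ₘ X.pi1.symm b) ≫ e = e ≫ X.pi1.symm (X.cls x • b) := by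
    rw [cls, ← (IsIso.inv_comp_eq e), Equiv.eq_symm_apply, X.pi1_smul, Equiv.apply_symm_apply]
  rw [← cancel_epi (𝟙 x ⊙ₘ (ρ_ y).hom), mulHom_comp_mulHom, rightUnitor_aut, ← mulHom_comp_mulHom
    (𝟙 x) _ (𝟙 x), ← he, ← id_tensorHom]
  have h₃ := ldis_natural (𝟙 x) (𝟙 y) (X.pi1.symm b)
  rw [reassoc_of% h₃, id_mulHom_id, id_tensorHom, Category.assoc, Category.assoc, rightUnitor_aut,
    ← MonoidalCategory.whiskerLeft_comp_assoc, h₁, MonoidalCategory.whiskerLeft_comp_assoc]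

theorem aut_mulHom_id (x y : X.C) (b : B) :
    (X.aut x b ⊙ₘ 𝟙 y) = X.aut (x ⊙ y) (b <• X.cls y) := by
  obtain ⟨e, he⟩ := X.exists_unit_mul x y
  have h₁ : (X.pi1.symm b ⊙ₘ 𝟙 y) ≫ e = e ≫ X.pi1.symm (b <• X.cls y) := by
    rw [cls, ← (IsIso.inv_comp_eq e), Equiv.eq_symm_apply, X.pi1_op_smul, Equiv.apply_symm_apply]
  rw [← cancel_epi ((ρ_ x).hom ⊙ₘ 𝟙 y), mulHom_comp_mulHom, rightUnitor_aut, ← mulHom_comp_mulHom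
    _ (𝟙 y) _ (𝟙 y), ← he, ← id_tensorHom]
  have h₃ := rdis_natural (𝟙 x) (X.pi1.symm b) (𝟙 y)
  rw [reassoc_of% h₃, id_mulHom_id, id_tensorHom, Category.assoc, Category.assoc, rightUnitor_aut,
    ← MonoidalCategory.whiskerLeft_comp_assoc, h₁, MonoidalCategory.whiskerLeft_comp_assoc]

theorem comp_aut_tensorHom_comp_aut {x x' y y' : X.C} (f : x ⟶ x') (g : y ⟶ y') (b c : B) :
    (f ≫ X.aut x' b) ⊗ₘ (g ≫ X.aut y' c) = (f ⊗ₘ g) ≫ X.aut (x' ⊗ y') (b + c) := by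
  rw [← tensorHom_comp_tensorHom, MonoidalCategory.tensorHom_def (X.aut _ _), aut_whiskerRight, whiskerLeft_aut,
    aut_add]

theorem comp_aut_mulHom_comp_aut {x x' y y' : X.C} (f : x ⟶ x') (g : y ⟶ y') (b c : B) :
    ((f ≫ X.aut x' b) ⊙ₘ (g ≫ X.aut y' c)) =
      (f ⊙ₘ g) ≫ X.aut (x' ⊙ y') (b <• X.cls y' + X.cls x' • c) := by
  have h : (X.aut x' b ⊙ₘ X.aut y' c) = (X.aut x' b ⊙ₘ 𝟙 y') ≫ (𝟙 x' ⊙ₘ X.aut y' c) := by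
    rw [mulHom_comp_mulHom, Category.id_comp, Category.comp_id]
  rw [← mulHom_comp_mulHom, h, aut_mulHom_id, id_mulHom_aut, aut_add]

end CrossedExtension

namespace CrossedExtension

variable {R : Type u} [Ring R] {B : Type v} [AddCommGroup B] [Module R B] [Module Rᵐᵒᵖ B]
  [SMulCommClass R Rᵐᵒᵖ B] (X : CrossedExtension R B)

/-! ### Valuations -/

/-- A chosen object in each class. -/
noncomputable def rep (r : R) : X.C := (X.exists_cls r).choose

theorem cls_rep (r : R) : X.cls (X.rep r) = r := (X.exists_cls r).choose_spec

/-- A valuation assigns an element of `π₁ = B` to every morphism, compatibly with composition, and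
compatibly with addition and multiplication up to given functions of pairs of objects. -/
structure Valuation where
  val : ∀ {x y : X.C}, (x ⟶ y) → B
  κ : X.C → X.C → B
  ν : X.C → X.C → B
  val_comp : ∀ {x y z : X.C} (f : x ⟶ y) (g : y ⟶ z), val (f ≫ g) = val f + val g
  val_unit : ∀ β : 𝟙_ X.C ⟶ 𝟙_ X.C, val β = X.pi1 β
  val_tensorHom : ∀ {x x' y y' : X.C} (f : x ⟶ x') (g : y ⟶ y'),
    val (f ⊗ₘ g) = val f + val g + κ x' y' - κ x y
  val_mulHom : ∀ {x x' y y' : X.C} (f : x ⟶ x') (g : y ⟶ y'),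
    val (f ⊙ₘ g) = val f <• X.cls y + X.cls x • val g + ν x' y' - ν x y

/-- Every crossed extension has a valuation. -/
theorem nonempty_valuation : Nonempty X.Valuation := by
  have hτ : ∀ x, Nonempty (x ⟶ X.rep (X.cls x)) := fun x => X.exists_hom (X.cls_rep _).symm
  let τ := fun x => (hτ x).some
  -- The value of `f` is its deviation from the reference morphism through the chosen
  -- representatives; `eqToHom` identifies the representatives of the equal classes of `x` and `y`.
  have hval : ∀ {x y : X.C} (f : x ⟶ y), ∃ b, f ≫ τ y =
      (τ x ≫ eqToHom (congrArg X.rep (X.cls_eq f))) ≫ X.aut _ b :=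
    fun f => X.exists_eq_comp_aut _ _
  choose val hval using @hval
  have val_eq : ∀ {x y : X.C} (f : x ⟶ y) (b : B), f ≫ τ y =
      (τ x ≫ eqToHom (congrArg X.rep (X.cls_eq f))) ≫ X.aut _ b → val f = b := fun f b h =>
    X.comp_aut_injective _ ((hval f).symm.trans h)
  have val_comp : ∀ {x y z : X.C} (f : x ⟶ y) (g : y ⟶ z), val (f ≫ g) = val f + val g := by
    intro x y z f g
    apply val_eq
    rw [Category.assoc, hval g, Category.assoc, reassoc_of% hval f, Category.assoc,
      ← reassoc_of% (X.comp_aut (eqToHom (congrArg X.rep (X.cls_eq g))) (val f)), aut_add]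
    simp
  have val_aut : ∀ (x : X.C) (b : B), val (X.aut x b) = b := by
    intro x b
    apply val_eq
    rw [← comp_aut]
    simp
  have val_id : ∀ x : X.C, val (𝟙 x) = 0 := fun x => by
    rw [← X.aut_zero, val_aut]
  have val_tensor_eqToHom : ∀ {r r' s s' : R} (h : r = r') (h' : s = s'),
      val (eqToHom (congrArg X.rep h) ⊗ₘ eqToHom (congrArg X.rep h')) = 0 := by
    intro r r' s s' h h'
    subst h h'
    simp [val_id]
  have val_mul_eqToHom : ∀ {r r' s s' : R} (h : r = r') (h' : s = s'),
      val (eqToHom (congrArg X.rep h) ⊙ₘ eqToHom (congrArg X.rep h')) = 0 := by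
    intro r r' s s' h h'
    subst h h'
    simp [id_mulHom_id, val_id]
  -- The corrections measure how far the trivializations `τ` are from being additive and
  -- multiplicative.
  refine ⟨⟨val, fun x y => - val (τ x ⊗ₘ τ y), fun x y => - val (τ x ⊙ₘ τ y), val_comp,
    fun β => ?_, fun {x x' y y'} f g => ?_, fun {x x' y y'} f g => ?_⟩⟩
  · conv_lhs => rw [← X.pi1.symm_apply_apply β, ← aut_unit]
    rw [val_aut]
  · have h : (f ⊗ₘ g) ≫ (τ x' ⊗ₘ τ y') = (τ x ⊗ₘ τ y) ≫
        (eqToHom (congrArg X.rep (X.cls_eq f)) ⊗ₘ eqToHom (congrArg X.rep (X.cls_eq g))) ≫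
          X.aut _ (val f + val g) := by
      rw [tensorHom_comp_tensorHom, hval f, hval g, comp_aut_tensorHom_comp_aut,
        ← tensorHom_comp_tensorHom, Category.assoc]
    have h' := congrArg val h
    rw [val_comp, val_comp, val_comp, val_aut, val_tensor_eqToHom (X.cls_eq f) (X.cls_eq g)] at h'
    linear_combination (norm := abel) h'
  · have hc : val f <• X.cls y' + X.cls x' • val g = val f <• X.cls y + X.cls x • val g := by
      rw [X.cls_eq f, X.cls_eq g]
    have h : (f ⊙ₘ g) ≫ (τ x' ⊙ₘ τ y') = (τ x ⊙ₘ τ y) ≫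
        (eqToHom (congrArg X.rep (X.cls_eq f)) ⊙ₘ eqToHom (congrArg X.rep (X.cls_eq g))) ≫
          X.aut _ (val f <• X.cls y + X.cls x • val g) := by
      rw [mulHom_comp_mulHom, hval f, hval g, comp_aut_mulHom_comp_aut,
        ← mulHom_comp_mulHom, Category.assoc, X.cls_rep, X.cls_rep, hc]
    have h' := congrArg val h
    rw [val_comp, val_comp, val_comp, val_aut, val_mul_eqToHom (X.cls_eq f) (X.cls_eq g)] at h'
    linear_combination (norm := abel) h'

namespace Valuation

variable {X} (V : X.Valuation)

@[simp] theorem val_id (x : X.C) : V.val (𝟙 x) = 0 := by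
  have h := V.val_comp (𝟙 x) (𝟙 x)
  simpa using h

@[simp] theorem val_inv {x y : X.C} (f : x ⟶ y) [IsIso f] : V.val (inv f) = - V.val f := by
  have h := V.val_comp (inv f) f
  rw [IsIso.inv_hom_id, val_id] at h
  exact eq_neg_of_add_eq_zero_left h.symm

@[simp] theorem val_iso_inv {x y : X.C} (i : x ≅ y) : V.val i.inv = - V.val i.hom := by
  rw [← V.val_inv, IsIso.Iso.inv_hom]

@[simp] theorem val_eqToHom {x y : X.C} (h : x = y) : V.val (eqToHom h) = 0 := by
  subst h; simp

@[simp] theorem val_whiskerLeft (x : X.C) {y y' : X.C} (g : y ⟶ y') :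
    V.val (x ◁ g) = V.val g + V.κ x y' - V.κ x y := by
  rw [← id_tensorHom, val_tensorHom, val_id, zero_add]

@[simp] theorem val_whiskerRight {x x' : X.C} (f : x ⟶ x') (y : X.C) :
    V.val (f ▷ y) = V.val f + V.κ x' y - V.κ x y := by
  rw [← tensorHom_id, val_tensorHom, val_id, add_zero]

@[simp] theorem val_aut (x : X.C) (b : B) : V.val (X.aut x b) = b := by
  simp [aut, V.val_comp, V.val_unit]

@[simp] theorem val_shift {x y : X.C} (f : x ⟶ y) (b : B) : V.val (X.shift f b) = V.val f + b := by
  rw [shift_eq, V.val_comp, val_aut]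

/-- Parallel morphisms differ by a shift, and the valuation sees this shift. Diagrams can thus be
checked in `B`. -/
theorem val_injective {x y : X.C} {f g : x ⟶ y} (h : V.val f = V.val g) : f = g := by
  obtain ⟨b, rfl⟩ := X.exists_eq_comp_aut f g
  have hb : b = 0 := by simpa [V.val_comp] using h
  rw [hb, aut_zero, Category.comp_id]

theorem exists_val_eq {x y : X.C} (h : X.cls x = X.cls y) (b : B) : ∃ f : x ⟶ y, V.val f = b := by
  obtain ⟨f⟩ := X.exists_hom h
  exact ⟨f ≫ X.aut y (b - V.val f), by simp [V.val_comp]⟩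

/-- The morphism of given value between objects of the same class. -/
noncomputable def homOf {x y : X.C} (h : X.cls x = X.cls y) (b : B) : x ⟶ y :=
  (V.exists_val_eq h b).choose

@[simp] theorem val_homOf {x y : X.C} (h : X.cls x = X.cls y) (b : B) : V.val (V.homOf h b) = b :=
  (V.exists_val_eq h b).choose_spec

/-! ### The cochain of a valuation -/

theorem exists_hom_rep (x : X.C) : Nonempty (X.rep (X.cls x) ⟶ x) := X.exists_hom (X.cls_rep _)

/-- The function on `R` induced by the additive associativity constraint. -/
noncomputable def addAssoc (r s t : R) : B :=
  V.κ (X.rep r) (X.rep s) + V.κ (X.rep r ⊗ X.rep s) (X.rep t)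
    + V.val (α_ (X.rep r) (X.rep s) (X.rep t)).hom
    - V.κ (X.rep s) (X.rep t) - V.κ (X.rep r) (X.rep s ⊗ X.rep t)

/-- Naturality along morphisms from the representatives: their own values cancel, and the change in
the value of the constraint is exactly the change in the `κ` terms. The other `_cls` lemmas for
natural constraints rest on the same cancellation, with `ν` where products occur. -/
theorem addAssoc_cls (x y z : X.C) : V.addAssoc (X.cls x) (X.cls y) (X.cls z) =
    V.κ x y + V.κ (x ⊗ y) z + V.val (α_ x y z).hom - V.κ y z - V.κ x (y ⊗ z) := by
  obtain ⟨f⟩ := exists_hom_rep x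
  obtain ⟨g⟩ := exists_hom_rep y
  obtain ⟨h⟩ := exists_hom_rep z
  have e := congrArg V.val (associator_naturality f g h)
  simp only [V.val_comp, V.val_tensorHom] at e
  rw [addAssoc]
  linear_combination (norm := abel) -e

/-- The function on `R` induced by the additive symmetry. -/
noncomputable def addSymm (r s : R) : B :=
  V.κ (X.rep r) (X.rep s) + V.val (β_ (X.rep r) (X.rep s)).hom - V.κ (X.rep s) (X.rep r)

theorem addSymm_cls (x y : X.C) : V.addSymm (X.cls x) (X.cls y) =
    V.κ x y + V.val (β_ x y).hom - V.κ y x := by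
  obtain ⟨f⟩ := exists_hom_rep x
  obtain ⟨g⟩ := exists_hom_rep y
  have e := congrArg V.val (BraidedCategory.braiding_naturality f g)
  simp only [V.val_comp, V.val_tensorHom] at e
  rw [addSymm]
  linear_combination (norm := abel) -e

/-- The function on `R` induced by the additive left unit constraint. -/
noncomputable def addLeftUnit (r : R) : B := V.κ (𝟙_ X.C) (X.rep r) + V.val (λ_ (X.rep r)).hom

theorem addLeftUnit_cls (x : X.C) : V.addLeftUnit (X.cls x) =
    V.κ (𝟙_ X.C) x + V.val (λ_ x).hom := by
  obtain ⟨f⟩ := exists_hom_rep x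
  have e := congrArg V.val (leftUnitor_naturality f)
  simp only [V.val_comp, V.val_whiskerLeft] at e
  rw [addLeftUnit]
  linear_combination (norm := abel) -e

/-- The function on `R` induced by the additive right unit constraint. -/
noncomputable def addRightUnit (r : R) : B := V.κ (X.rep r) (𝟙_ X.C) + V.val (ρ_ (X.rep r)).hom

theorem addRightUnit_cls (x : X.C) : V.addRightUnit (X.cls x) =
    V.κ x (𝟙_ X.C) + V.val (ρ_ x).hom := by
  obtain ⟨f⟩ := exists_hom_rep x
  have e := congrArg V.val (rightUnitor_naturality f)
  simp only [V.val_comp, V.val_whiskerRight] at e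
  rw [addRightUnit]
  linear_combination (norm := abel) -e

/-- The function on `R` induced by the multiplicative left unit constraint. -/
noncomputable def mulLeftUnit (r : R) : B :=
  V.ν (oneObj X.C) (X.rep r) + V.val (oneMul (X.rep r)).hom

theorem mulLeftUnit_cls (x : X.C) : V.mulLeftUnit (X.cls x) =
    V.ν (oneObj X.C) x + V.val (oneMul x).hom := by
  obtain ⟨f⟩ := exists_hom_rep x
  have e := congrArg V.val (oneMul_natural f)
  simp only [V.val_comp, V.val_mulHom, val_id, smul_zero, X.cls_one, one_smul] at e
  rw [mulLeftUnit]
  linear_combination (norm := abel) -e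

/-- The function on `R` induced by the multiplicative right unit constraint. -/
noncomputable def mulRightUnit (r : R) : B :=
  V.ν (X.rep r) (oneObj X.C) + V.val (mulOne (X.rep r)).hom

theorem mulRightUnit_cls (x : X.C) : V.mulRightUnit (X.cls x) =
    V.ν x (oneObj X.C) + V.val (mulOne x).hom := by
  obtain ⟨f⟩ := exists_hom_rep x
  have e := congrArg V.val (mulOne_natural f)
  simp only [V.val_comp, V.val_mulHom, val_id, smul_zero, X.cls_one, one_smul,
    MulOpposite.op_one] at e
  rw [mulRightUnit]
  linear_combination (norm := abel) -e

/-- The function on `R` induced by the multiplicative associativity constraint. -/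
noncomputable def mulAss (r s t : R) : B :=
  V.ν (X.rep r) (X.rep s) <• t + V.ν (X.rep r ⊙ X.rep s) (X.rep t)
    + V.val (mulAssoc (X.rep r) (X.rep s) (X.rep t)).hom
    - r • V.ν (X.rep s) (X.rep t) - V.ν (X.rep r) (X.rep s ⊙ X.rep t)

theorem mulAss_cls (x y z : X.C) : V.mulAss (X.cls x) (X.cls y) (X.cls z) =
    V.ν x y <• X.cls z + V.ν (x ⊙ y) z + V.val (mulAssoc x y z).hom
      - X.cls x • V.ν y z - V.ν x (y ⊙ z) := by
  obtain ⟨f⟩ := exists_hom_rep x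
  obtain ⟨g⟩ := exists_hom_rep y
  obtain ⟨h⟩ := exists_hom_rep z
  have e := congrArg V.val (mulAssoc_natural f g h)
  simp only [V.val_comp, V.val_mulHom, X.cls_mul, X.cls_rep, smul_add, smul_sub, mul_smul,
    MulOpposite.op_mul, smul_comm (_ : R) (_ : Rᵐᵒᵖ) (_ : B)] at e
  rw [mulAss]
  linear_combination (norm := abel) -e

/-- The function on `R` induced by left distributivity. -/
noncomputable def leftDist (r s₀ s₁ : R) : B :=
  r • V.κ (X.rep s₀) (X.rep s₁) + V.ν (X.rep r) (X.rep s₀ ⊗ X.rep s₁)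
    + V.val (ldis (X.rep r) (X.rep s₀) (X.rep s₁))
    - V.ν (X.rep r) (X.rep s₀) - V.ν (X.rep r) (X.rep s₁)
    - V.κ (X.rep r ⊙ X.rep s₀) (X.rep r ⊙ X.rep s₁)

theorem leftDist_cls (x y z : X.C) : V.leftDist (X.cls x) (X.cls y) (X.cls z) =
    X.cls x • V.κ y z + V.ν x (y ⊗ z) + V.val (ldis x y z) - V.ν x y - V.ν x z
      - V.κ (x ⊙ y) (x ⊙ z) := by
  obtain ⟨f⟩ := exists_hom_rep x
  obtain ⟨g⟩ := exists_hom_rep y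
  obtain ⟨h⟩ := exists_hom_rep z
  have e := congrArg V.val (ldis_natural f g h)
  simp only [V.val_comp, V.val_mulHom, V.val_tensorHom, X.cls_tensor, X.cls_rep, smul_add,
    smul_sub, add_smul, MulOpposite.op_add] at e
  rw [leftDist]
  linear_combination (norm := abel) -e

/-- The function on `R` induced by right distributivity. -/
noncomputable def rightDist (r₀ r₁ s : R) : B :=
  V.κ (X.rep r₀) (X.rep r₁) <• s + V.ν (X.rep r₀ ⊗ X.rep r₁) (X.rep s)
    + V.val (rdis (X.rep r₀) (X.rep r₁) (X.rep s))
    - V.ν (X.rep r₀) (X.rep s) - V.ν (X.rep r₁) (X.rep s)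
    - V.κ (X.rep r₀ ⊙ X.rep s) (X.rep r₁ ⊙ X.rep s)

theorem rightDist_cls (x y z : X.C) : V.rightDist (X.cls x) (X.cls y) (X.cls z) =
    V.κ x y <• X.cls z + V.ν (x ⊗ y) z + V.val (rdis x y z) - V.ν x z - V.ν y z
      - V.κ (x ⊙ z) (y ⊙ z) := by
  obtain ⟨f⟩ := exists_hom_rep x
  obtain ⟨g⟩ := exists_hom_rep y
  obtain ⟨h⟩ := exists_hom_rep z
  have e := congrArg V.val (rdis_natural f g h)
  simp only [V.val_comp, V.val_mulHom, V.val_tensorHom, X.cls_tensor, X.cls_rep, smul_add,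
    smul_sub, add_smul, MulOpposite.op_add] at e
  rw [rightDist]
  linear_combination (norm := abel) -e

/-- The function on `R` induced by the additive interchange isomorphism. -/
noncomputable def interchange (w x y z : R) : B :=
  V.addAssoc w x (y + z) - V.addAssoc x y z + V.addSymm x y + V.addAssoc y x z
    - V.addAssoc w y (x + z)

/-- `tensorμ` is composed of four associators and one braiding, and the intermediate `κ` terms
telescope. -/
theorem interchange_cls (w x y z : X.C) :
    V.interchange (X.cls w) (X.cls x) (X.cls y) (X.cls z) =
      V.κ w x + V.κ y z + V.κ (w ⊗ x) (y ⊗ z) + V.val (tensorμ w x y z)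
        - V.κ w y - V.κ x z - V.κ (w ⊗ y) (x ⊗ z) := by
  simp only [interchange, tensorμ, V.val_comp, val_whiskerLeft, val_whiskerRight, val_iso_inv,
    ← X.cls_tensor, addAssoc_cls, addSymm_cls]
  abel

/-- The characteristic quadruple of a valuation. -/
noncomputable def cochain : Quadruple R B := (V.mulAss, V.leftDist, V.rightDist, V.interchange)

end Valuation

end CrossedExtension

namespace CrossedExtension.Valuation

variable {R : Type u} [Ring R] {B : Type v} [AddCommGroup B] [Module R B] [Module Rᵐᵒᵖ B]
  [SMulCommClass R Rᵐᵒᵖ B] {X : CrossedExtension R B} (V : X.Valuation)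

/-! ### Coherence of the functions induced by the constraints -/

/-- Taking values on both sides of the coherence diagram leaves an identity between the corrected
constraints, as the corrections at interior vertices cancel. The identities below that come from a
single diagram are obtained in the same way. -/
theorem add_pentagon (r s t w : R) :
    V.addAssoc r s t + V.addAssoc r (s + t) w + V.addAssoc s t w =
      V.addAssoc (r + s) t w + V.addAssoc r s (t + w) := by
  obtain ⟨r, rfl⟩ := X.exists_cls r
  obtain ⟨s, rfl⟩ := X.exists_cls s
  obtain ⟨t, rfl⟩ := X.exists_cls t
  obtain ⟨w, rfl⟩ := X.exists_cls w
  have h := congrArg V.val (MonoidalCategory.pentagon r s t w)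
  simp only [V.val_comp, val_whiskerLeft, val_whiskerRight] at h
  simp only [← X.cls_tensor, addAssoc_cls]
  linear_combination (norm := abel) h

theorem add_hexagon (r s t : R) :
    V.addAssoc r s t + V.addSymm r (s + t) + V.addAssoc s t r =
      V.addSymm r s + V.addAssoc s r t + V.addSymm r t := by
  obtain ⟨r, rfl⟩ := X.exists_cls r
  obtain ⟨s, rfl⟩ := X.exists_cls s
  obtain ⟨t, rfl⟩ := X.exists_cls t
  have h := congrArg V.val (BraidedCategory.hexagon_forward r s t)
  simp only [V.val_comp, val_whiskerLeft, val_whiskerRight] at h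
  simp only [← X.cls_tensor, addAssoc_cls, addSymm_cls]
  linear_combination (norm := abel) h

theorem addSymm_add_addSymm (r s : R) : V.addSymm r s + V.addSymm s r = 0 := by
  obtain ⟨r, rfl⟩ := X.exists_cls r
  obtain ⟨s, rfl⟩ := X.exists_cls s
  have h := congrArg V.val (SymmetricCategory.symmetry r s)
  simp only [V.val_comp, val_id] at h
  simp only [addSymm_cls]
  linear_combination (norm := abel) h

theorem addAssoc_zero_mid (r s : R) :
    V.addAssoc r 0 s = V.addRightUnit r - V.addLeftUnit s := by
  obtain ⟨r, rfl⟩ := X.exists_cls r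
  obtain ⟨s, rfl⟩ := X.exists_cls s
  have h := congrArg V.val (MonoidalCategory.triangle r s)
  simp only [V.val_comp, val_whiskerLeft, val_whiskerRight] at h
  simp only [← X.cls_unit, addAssoc_cls, addRightUnit_cls, addLeftUnit_cls]
  linear_combination (norm := abel) h

theorem addAssoc_zero_left (r s : R) :
    V.addAssoc 0 r s = V.addLeftUnit r - V.addLeftUnit (r + s) := by
  obtain ⟨r, rfl⟩ := X.exists_cls r
  obtain ⟨s, rfl⟩ := X.exists_cls s
  have h := congrArg V.val (leftUnitor_tensor_hom r s)
  simp only [V.val_comp, val_iso_inv, val_whiskerRight] at h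
  simp only [← X.cls_unit, ← X.cls_tensor, addAssoc_cls, addRightUnit_cls, addLeftUnit_cls]
  linear_combination (norm := abel) h

theorem addAssoc_zero_right (r s : R) :
    V.addAssoc r s 0 = V.addRightUnit (r + s) - V.addRightUnit s := by
  obtain ⟨r, rfl⟩ := X.exists_cls r
  obtain ⟨s, rfl⟩ := X.exists_cls s
  have h := congrArg V.val (rightUnitor_tensor_hom r s)
  simp only [V.val_comp, val_whiskerLeft] at h
  simp only [← X.cls_unit, ← X.cls_tensor, addAssoc_cls, addRightUnit_cls, addLeftUnit_cls]
  linear_combination (norm := abel) -h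

theorem addSymm_zero_right (r : R) : V.addSymm r 0 = V.addRightUnit r - V.addLeftUnit r := by
  obtain ⟨r, rfl⟩ := X.exists_cls r
  have h := congrArg V.val (braiding_leftUnitor r)
  simp only [V.val_comp] at h
  simp only [← X.cls_unit, addSymm_cls, addRightUnit_cls, addLeftUnit_cls]
  linear_combination (norm := abel) h

theorem addSymm_zero_left (r : R) : V.addSymm 0 r = V.addLeftUnit r - V.addRightUnit r := by
  have h := V.addSymm_add_addSymm 0 r
  rw [addSymm_zero_right] at h
  linear_combination (norm := abel) h

theorem addLeftUnit_zero : V.addLeftUnit 0 = V.addRightUnit 0 := by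
  rw [← X.cls_unit, addLeftUnit_cls, addRightUnit_cls, unitors_equal]

theorem mulAss_one_mid (r s : R) :
    V.mulAss r 1 s = V.mulRightUnit r <• s - r • V.mulLeftUnit s := by
  obtain ⟨r, rfl⟩ := X.exists_cls r
  obtain ⟨s, rfl⟩ := X.exists_cls s
  have h := congrArg V.val (mul_triangle r s)
  simp only [V.val_comp, V.val_mulHom, val_id, smul_zero] at h
  simp only [← X.cls_one, mulAss_cls, mulRightUnit_cls, mulLeftUnit_cls, smul_add]
  linear_combination (norm := abel) h

theorem mulLeftUnit_one : V.mulLeftUnit 1 = V.mulRightUnit 1 := by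
  rw [← X.cls_one, mulLeftUnit_cls, mulRightUnit_cls, oneMul_one]

/-- Not one of the cocycle equations; with a middle summand `0` it controls how distributivity
interacts with the additive units. -/
theorem leftDist_addAssoc (r s₀ s₁ s₂ : R) :
    V.leftDist r (s₀ + s₁) s₂ + V.leftDist r s₀ s₁ + V.addAssoc (r * s₀) (r * s₁) (r * s₂) =
      r • V.addAssoc s₀ s₁ s₂ + V.leftDist r s₀ (s₁ + s₂) + V.leftDist r s₁ s₂ := by
  obtain ⟨r, rfl⟩ := X.exists_cls r
  obtain ⟨s₀, rfl⟩ := X.exists_cls s₀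
  obtain ⟨s₁, rfl⟩ := X.exists_cls s₁
  obtain ⟨s₂, rfl⟩ := X.exists_cls s₂
  have h := congrArg V.val (ldis_add_assoc r s₀ s₁ s₂)
  simp only [V.val_comp, V.val_mulHom, V.val_tensorHom, val_id, smul_zero] at h
  simp only [← X.cls_tensor, ← X.cls_mul, addAssoc_cls, leftDist_cls, smul_add, smul_sub]
  linear_combination (norm := abel) h

theorem rightDist_addAssoc (r₀ r₁ r₂ s : R) :
    V.rightDist (r₀ + r₁) r₂ s + V.rightDist r₀ r₁ s + V.addAssoc (r₀ * s) (r₁ * s) (r₂ * s) =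
      V.addAssoc r₀ r₁ r₂ <• s + V.rightDist r₀ (r₁ + r₂) s + V.rightDist r₁ r₂ s := by
  obtain ⟨r₀, rfl⟩ := X.exists_cls r₀
  obtain ⟨r₁, rfl⟩ := X.exists_cls r₁
  obtain ⟨r₂, rfl⟩ := X.exists_cls r₂
  obtain ⟨s, rfl⟩ := X.exists_cls s
  have h := congrArg V.val (rdis_add_assoc r₀ r₁ r₂ s)
  simp only [V.val_comp, V.val_mulHom, V.val_tensorHom, val_id, smul_zero] at h
  simp only [← X.cls_tensor, ← X.cls_mul, addAssoc_cls, rightDist_cls, smul_add, smul_sub]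
  linear_combination (norm := abel) h

theorem interchange_def (w x y z : R) : V.interchange w x y z =
    V.addAssoc w x (y + z) - V.addAssoc x y z + V.addSymm x y + V.addAssoc y x z
      - V.addAssoc w y (x + z) := rfl

/-- Addition, as a functor of two variables, is monoidal with structure morphisms `tensorμ`. -/
theorem interchange_addAssoc (x₀ x₁ y₀ y₁ z₀ z₁ : R) :
    V.interchange x₀ x₁ y₀ y₁ + V.interchange (x₀ + y₀) (x₁ + y₁) z₀ z₁ + V.addAssoc x₀ y₀ z₀
        + V.addAssoc x₁ y₁ z₁ =
      V.addAssoc (x₀ + x₁) (y₀ + y₁) (z₀ + z₁) + V.interchange y₀ y₁ z₀ z₁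
        + V.interchange x₀ x₁ (y₀ + z₀) (y₁ + z₁) := by
  obtain ⟨x₀, rfl⟩ := X.exists_cls x₀
  obtain ⟨x₁, rfl⟩ := X.exists_cls x₁
  obtain ⟨y₀, rfl⟩ := X.exists_cls y₀
  obtain ⟨y₁, rfl⟩ := X.exists_cls y₁
  obtain ⟨z₀, rfl⟩ := X.exists_cls z₀
  obtain ⟨z₁, rfl⟩ := X.exists_cls z₁
  have h := congrArg V.val (tensor_associativity x₀ x₁ y₀ y₁ z₀ z₁)
  simp only [V.val_comp, V.val_tensorHom, val_whiskerLeft, val_whiskerRight] at h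
  simp only [← X.cls_tensor, addAssoc_cls, interchange_cls]
  linear_combination (norm := abel) h

/-- Addition, as a functor of two variables, also respects the symmetry. Both composites exchange
two pairs, so the identity is a combination of one pentagon, hexagons and symmetry. -/
theorem interchange_addSymm (w x y z : R) :
    V.interchange w x y z + V.addSymm w y + V.addSymm x z =
      V.addSymm (w + x) (y + z) + V.interchange y z w x := by
  simp only [interchange]
  have p := V.add_pentagon w x z y
  have h₁ := V.add_hexagon z w x
  have h₂ := V.add_hexagon y w (x + z)
  have h₃ := V.add_hexagon y (w + x) z
  have h₄ := V.add_hexagon (w + x) y z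
  have h₅ := V.add_hexagon y x z
  have s₁ := V.addSymm_add_addSymm y (w + x)
  have s₂ := V.addSymm_add_addSymm z (w + x)
  have s₃ := V.addSymm_add_addSymm w y
  have s₄ := V.addSymm_add_addSymm x y
  have s₅ := V.addSymm_add_addSymm x z
  rw [add_comm z y] at p
  rw [← add_assoc w x z] at h₂
  rw [add_comm z x]
  linear_combination (norm := abel) h₁ + h₂ - h₃ - h₄ + h₅ - p - s₁ - s₂ + s₃ + s₄ + s₅

/-- Interchange of the pairs `(a, b)`, `(c, d)`, `(e, f)`, `(g, h)` is built from four associators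
and one symmetry. Addition of the two components respects each of these five factors, hence respects
interchange. -/
theorem interchange_cube (a b c d e f g h : R) :
    V.interchange (a + b) (c + d) (e + f) (g + h) + V.interchange a b e f + V.interchange c d g h
        + V.interchange (a + e) (b + f) (c + g) (d + h) =
      V.interchange a b c d + V.interchange e f g h
        + V.interchange (a + c) (b + d) (e + g) (f + h)
        + V.interchange a c e g + V.interchange b d f h := by
  have h₁ := V.interchange_addAssoc a b c d (e + g) (f + h)
  have h₂ := V.interchange_addAssoc c d e f g h
  have h₃ := V.interchange_addSymm c d e f
  have h₄ := V.interchange_addAssoc e f c d g h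
  have h₅ := V.interchange_addAssoc a b e f (c + g) (d + h)
  rw [add_add_add_comm e g f h] at h₁
  rw [add_comm e c, add_comm f d] at h₄
  rw [add_add_add_comm c g d h, add_left_comm e c g, add_left_comm f d h] at h₅
  rw [V.interchange_def (a + b), V.interchange_def a c, V.interchange_def b d f h]
  linear_combination (norm := abel) -h₁ + h₂ - h₃ - h₄ + h₅

/-- The cochain of a valuation satisfies the cocycle equations. -/
theorem isCocycle_cochain : V.cochain.IsCocycle where
  eq₁ r s t w := by
    obtain ⟨r, rfl⟩ := X.exists_cls r
    obtain ⟨s, rfl⟩ := X.exists_cls s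
    obtain ⟨t, rfl⟩ := X.exists_cls t
    obtain ⟨w, rfl⟩ := X.exists_cls w
    have h := congrArg V.val (mul_pentagon r s t w)
    simp only [V.val_comp, V.val_mulHom, val_id, smul_zero] at h
    change _ • V.mulAss _ _ _ - V.mulAss _ _ _ + V.mulAss _ _ _ - V.mulAss _ _ _
      + V.mulAss _ _ _ <• _ = 0
    -- Products of classes become classes of products, so that the constraint is evaluated at the
    -- very objects of the diagram; afterwards they are split again to compare the scalars.
    simp only [← X.cls_mul, mulAss_cls]
    simp only [X.cls_mul, smul_add, smul_sub, mul_smul, MulOpposite.op_mul,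
      smul_comm (_ : R) (_ : Rᵐᵒᵖ) (_ : B)]
    linear_combination (norm := abel) h
  eq₂ r s t₀ t₁ := by
    obtain ⟨r, rfl⟩ := X.exists_cls r
    obtain ⟨s, rfl⟩ := X.exists_cls s
    obtain ⟨t₀, rfl⟩ := X.exists_cls t₀
    obtain ⟨t₁, rfl⟩ := X.exists_cls t₁
    have h := congrArg V.val (ldis_assoc r s t₀ t₁)
    simp only [V.val_comp, V.val_mulHom, V.val_tensorHom, val_id, smul_zero] at h
    change _ • V.leftDist _ _ _ - V.leftDist _ _ _ + V.leftDist _ _ _ =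
      V.mulAss _ _ _ + V.mulAss _ _ _ - V.mulAss _ _ _
    simp only [← X.cls_mul, ← X.cls_tensor, mulAss_cls, leftDist_cls]
    simp only [X.cls_mul, X.cls_tensor, smul_add, smul_sub, mul_smul, add_smul,
      MulOpposite.op_mul, MulOpposite.op_add, smul_comm (_ : R) (_ : Rᵐᵒᵖ) (_ : B)]
    linear_combination (norm := abel) h
  eq₃ r s₀ s₁ t := by
    obtain ⟨r, rfl⟩ := X.exists_cls r
    obtain ⟨s₀, rfl⟩ := X.exists_cls s₀
    obtain ⟨s₁, rfl⟩ := X.exists_cls s₁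
    obtain ⟨t, rfl⟩ := X.exists_cls t
    have h := congrArg V.val (ldis_rdis_assoc r s₀ s₁ t)
    simp only [V.val_comp, V.val_mulHom, V.val_tensorHom, val_id, smul_zero] at h
    change V.leftDist _ _ _ - V.leftDist _ _ _ <• _ =
      V.rightDist _ _ _ - _ • V.rightDist _ _ _ +
        (V.mulAss _ _ _ + V.mulAss _ _ _ - V.mulAss _ _ _)
    simp only [← X.cls_mul, ← X.cls_tensor, mulAss_cls, leftDist_cls, rightDist_cls]
    simp only [X.cls_mul, X.cls_tensor, smul_add, smul_sub, mul_smul, add_smul,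
      MulOpposite.op_mul, MulOpposite.op_add, smul_comm (_ : R) (_ : Rᵐᵒᵖ) (_ : B)]
    linear_combination (norm := abel) -h
  eq₄ r₀ r₁ s t := by
    obtain ⟨r₀, rfl⟩ := X.exists_cls r₀
    obtain ⟨r₁, rfl⟩ := X.exists_cls r₁
    obtain ⟨s, rfl⟩ := X.exists_cls s
    obtain ⟨t, rfl⟩ := X.exists_cls t
    have h := congrArg V.val (rdis_assoc r₀ r₁ s t)
    simp only [V.val_comp, V.val_mulHom, V.val_tensorHom, val_id, smul_zero] at h
    change V.rightDist _ _ _ - V.rightDist _ _ _ + V.rightDist _ _ _ <• _ =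
      -(V.mulAss _ _ _ + V.mulAss _ _ _ - V.mulAss _ _ _)
    simp only [← X.cls_mul, ← X.cls_tensor, mulAss_cls, rightDist_cls]
    simp only [X.cls_mul, X.cls_tensor, smul_add, smul_sub, mul_smul, add_smul,
      MulOpposite.op_mul, MulOpposite.op_add, smul_comm (_ : R) (_ : Rᵐᵒᵖ) (_ : B)]
    linear_combination (norm := abel) h
  eq₅ r a b c d := by
    obtain ⟨r, rfl⟩ := X.exists_cls r
    obtain ⟨a, rfl⟩ := X.exists_cls a
    obtain ⟨b, rfl⟩ := X.exists_cls b
    obtain ⟨c, rfl⟩ := X.exists_cls c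
    obtain ⟨d, rfl⟩ := X.exists_cls d
    have h := congrArg V.val (ldis_interchange r a b c d)
    simp only [V.val_comp, V.val_mulHom, V.val_tensorHom, val_id, smul_zero] at h
    change V.interchange _ _ _ _ - _ • V.interchange _ _ _ _ =
      (V.leftDist _ _ _ + V.leftDist _ _ _ - V.leftDist _ _ _)
        - (V.leftDist _ _ _ + V.leftDist _ _ _ - V.leftDist _ _ _)
    simp only [Prod.mk_add_mk, ← X.cls_mul, ← X.cls_tensor, interchange_cls, leftDist_cls]
    simp only [smul_add, smul_sub]
    linear_combination (norm := abel) h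
  eq₆ r₀ r₁ s₀ s₁ := by
    obtain ⟨r₀, rfl⟩ := X.exists_cls r₀
    obtain ⟨r₁, rfl⟩ := X.exists_cls r₁
    obtain ⟨s₀, rfl⟩ := X.exists_cls s₀
    obtain ⟨s₁, rfl⟩ := X.exists_cls s₁
    have h := congrArg V.val (rdis_ldis_interchange r₀ r₁ s₀ s₁)
    simp only [V.val_comp, V.val_mulHom, V.val_tensorHom, val_id, smul_zero] at h
    change V.interchange _ _ _ _ =
      (V.rightDist _ _ _ + V.rightDist _ _ _ - V.rightDist _ _ _)
        - (V.leftDist _ _ _ + V.leftDist _ _ _ - V.leftDist _ _ _)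
    simp only [← X.cls_mul, ← X.cls_tensor, interchange_cls, leftDist_cls, rightDist_cls]
    simp only [X.cls_tensor, smul_add, smul_sub, add_smul, MulOpposite.op_add]
    linear_combination (norm := abel) h
  eq₇ a b c d r := by
    obtain ⟨r, rfl⟩ := X.exists_cls r
    obtain ⟨a, rfl⟩ := X.exists_cls a
    obtain ⟨b, rfl⟩ := X.exists_cls b
    obtain ⟨c, rfl⟩ := X.exists_cls c
    obtain ⟨d, rfl⟩ := X.exists_cls d
    have h := congrArg V.val (rdis_interchange a b c d r)
    simp only [V.val_comp, V.val_mulHom, V.val_tensorHom, val_id, smul_zero] at h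
    change V.interchange _ _ _ _ - V.interchange _ _ _ _ <• _ =
      (V.rightDist _ _ _ + V.rightDist _ _ _ - V.rightDist _ _ _)
        - (V.rightDist _ _ _ + V.rightDist _ _ _ - V.rightDist _ _ _)
    simp only [Prod.mk_add_mk, ← X.cls_mul, ← X.cls_tensor, interchange_cls, rightDist_cls]
    simp only [smul_add, smul_sub]
    linear_combination (norm := abel) h
  eq₈ a b c d e f g h := by
    have h' := V.interchange_cube a b c d e f g h
    change (V.interchange _ _ _ _ + V.interchange _ _ _ _ - V.interchange _ _ _ _)
      - (V.interchange _ _ _ _ + V.interchange _ _ _ _ - V.interchange _ _ _ _)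
      + (V.interchange _ _ _ _ + V.interchange _ _ _ _ - V.interchange _ _ _ _) = 0
    simp only [Prod.mk_add_mk]
    linear_combination (norm := abel) -h'

end CrossedExtension.Valuation

namespace CrossedExtension.Valuation

variable {R : Type u} [Ring R] {B : Type v} [AddCommGroup B] [Module R B] [Module Rᵐᵒᵖ B]
  [SMulCommClass R Rᵐᵒᵖ B] {X : CrossedExtension R B} (V : X.Valuation)

/-! ### Change of valuation -/

/-- The valuation changed by two functions on pairs of classes. -/
def modify (γm γa : R → R → B) : X.Valuation where
  val := V.val
  -- The opposite signs for `κ` and `ν` are those of the coboundary formulas.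
  κ x y := V.κ x y + γa (X.cls x) (X.cls y)
  ν x y := V.ν x y - γm (X.cls x) (X.cls y)
  val_comp := V.val_comp
  val_unit := V.val_unit
  val_tensorHom f g := by
    rw [V.val_tensorHom, X.cls_eq f, X.cls_eq g]
    abel
  val_mulHom f g := by
    rw [V.val_mulHom, X.cls_eq f, X.cls_eq g]
    abel

variable (γm γa : R → R → B)

theorem addLeftUnit_modify (r : R) : (V.modify γm γa).addLeftUnit r =
    V.addLeftUnit r + γa 0 r := by
  obtain ⟨r, rfl⟩ := X.exists_cls r
  rw [addLeftUnit_cls, addLeftUnit_cls]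
  simp only [modify, X.cls_unit]
  abel

theorem addRightUnit_modify (r : R) : (V.modify γm γa).addRightUnit r =
    V.addRightUnit r + γa r 0 := by
  obtain ⟨r, rfl⟩ := X.exists_cls r
  rw [addRightUnit_cls, addRightUnit_cls]
  simp only [modify, X.cls_unit]
  abel

theorem mulAss_modify (r s t : R) : (V.modify γm γa).mulAss r s t =
    V.mulAss r s t + (r • γm s t - γm (r * s) t + γm r (s * t) - γm r s <• t) := by
  obtain ⟨r, rfl⟩ := X.exists_cls r
  obtain ⟨s, rfl⟩ := X.exists_cls s
  obtain ⟨t, rfl⟩ := X.exists_cls t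
  rw [mulAss_cls, mulAss_cls]
  simp only [modify, X.cls_mul, smul_sub]
  abel

theorem leftDist_modify (r s₀ s₁ : R) : (V.modify γm γa).leftDist r s₀ s₁ =
    V.leftDist r s₀ s₁ + (r • γa s₀ s₁ - γa (r * s₀) (r * s₁)
      + (γm r s₀ + γm r s₁ - γm r (s₀ + s₁))) := by
  obtain ⟨r, rfl⟩ := X.exists_cls r
  obtain ⟨s₀, rfl⟩ := X.exists_cls s₀
  obtain ⟨s₁, rfl⟩ := X.exists_cls s₁
  rw [leftDist_cls, leftDist_cls]
  simp only [modify, X.cls_mul, X.cls_tensor, smul_add]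
  abel

theorem rightDist_modify (r₀ r₁ s : R) : (V.modify γm γa).rightDist r₀ r₁ s =
    V.rightDist r₀ r₁ s + (γa r₀ r₁ <• s - γa (r₀ * s) (r₁ * s)
      + (γm r₀ s + γm r₁ s - γm (r₀ + r₁) s)) := by
  obtain ⟨r₀, rfl⟩ := X.exists_cls r₀
  obtain ⟨r₁, rfl⟩ := X.exists_cls r₁
  obtain ⟨s, rfl⟩ := X.exists_cls s
  rw [rightDist_cls, rightDist_cls]
  simp only [modify, X.cls_mul, X.cls_tensor, smul_add]
  abel

theorem interchange_modify (w x y z : R) : (V.modify γm γa).interchange w x y z =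
    V.interchange w x y z + (γa w x + γa y z + γa (w + x) (y + z)
      - γa w y - γa x z - γa (w + y) (x + z)) := by
  obtain ⟨w, rfl⟩ := X.exists_cls w
  obtain ⟨x, rfl⟩ := X.exists_cls x
  obtain ⟨y, rfl⟩ := X.exists_cls y
  obtain ⟨z, rfl⟩ := X.exists_cls z
  rw [interchange_cls, interchange_cls]
  simp only [modify, X.cls_tensor]
  abel

/-- Changing a valuation changes its cochain by a coboundary. -/
theorem isCoboundaryOf_modify :
    ((V.modify γm γa).cochain - V.cochain).IsCoboundaryOf γm γa where
  m r s t := by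
    change (V.modify γm γa).mulAss r s t - V.mulAss r s t = _
    rw [mulAss_modify, add_sub_cancel_left]
  l r s t := by
    change (V.modify γm γa).leftDist r s t - V.leftDist r s t = _
    rw [leftDist_modify, add_sub_cancel_left]
    rfl
  r r s t := by
    change (V.modify γm γa).rightDist r s t - V.rightDist r s t = _
    rw [rightDist_modify, add_sub_cancel_left]
    rfl
  a w x y z := by
    change (V.modify γm γa).interchange w x y z - V.interchange w x y z =
      (γa _ _ + γa _ _ - γa (w + y) (x + z)) - (γa _ _ + γa _ _ - γa (w + x) (y + z))
    rw [interchange_modify]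
    abel

variable {γm γa}

/-- A coboundary is determined by `γm` and `γa`. So every quadruple cohomologous to the cochain of a
valuation is itself the cochain of a valuation. -/
theorem modify_cochain_eq {φ : Quadruple R B} (h : (φ - V.cochain).IsCoboundaryOf γm γa) :
    (V.modify γm γa).cochain = φ := by
  have h' := V.isCoboundaryOf_modify γm γa
  have key : (V.modify γm γa).cochain - V.cochain = φ - V.cochain := by
    refine Prod.ext ?_ (Prod.ext ?_ (Prod.ext ?_ ?_))
    · funext r s t; exact (h'.m r s t).trans (h.m r s t).symm
    · funext r s t; exact (h'.l r s t).trans (h.l r s t).symm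
    · funext r s t; exact (h'.r r s t).trans (h.r r s t).symm
    · funext w x y z; exact (h'.a w x y z).trans (h.a w x y z).symm
  exact sub_left_injective key

/-! ### Normalization -/

/-- On each degenerate matrix, interchange only involves associativities and symmetries with an
argument `0`, and these are differences of unit values. -/
theorem interchange_eq_zero_of_unital (hu : ∀ r, V.addRightUnit r = 0)
    (hv : ∀ r, V.addLeftUnit r = 0) :
    (∀ r s, V.interchange r s 0 0 = 0) ∧ (∀ r s, V.interchange 0 0 r s = 0) ∧
    (∀ r s, V.interchange r 0 s 0 = 0) ∧ (∀ r s, V.interchange 0 r 0 s = 0) ∧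
    (∀ r s, V.interchange r 0 0 s = 0) := by
  refine ⟨?_, ?_, ?_, ?_, ?_⟩ <;> intro r s <;>
  simp [interchange, addAssoc_zero_mid, addAssoc_zero_left, addAssoc_zero_right,
    addSymm_zero_right, addSymm_zero_left, hu, hv]

/-- Distributing `r` over `s + 0 + t` in two ways separates the variables: both sides are constant,
equal to the value at `s = t = 0`. -/
theorem leftDist_zero_eq (hu : ∀ r, V.addRightUnit r = 0) (hv : ∀ r, V.addLeftUnit r = 0)
    (r s t : R) : V.leftDist r s 0 = V.leftDist r 0 t := by
  have h := V.leftDist_addAssoc r s 0 t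
  simp only [addAssoc_zero_mid, mul_zero, hu, hv, add_zero, zero_add, sub_zero, smul_zero] at h
  simpa using h

theorem rightDist_zero_eq (hu : ∀ r, V.addRightUnit r = 0) (hv : ∀ r, V.addLeftUnit r = 0)
    (r s t : R) : V.rightDist r 0 t = V.rightDist 0 s t := by
  have h := V.rightDist_addAssoc r 0 s t
  simp only [addAssoc_zero_mid, zero_mul, hu, hv, add_zero, zero_add, sub_zero, smul_zero] at h
  simpa using h

/-- Vanishing propagates: the units settle `φ_+` and, with `hl` and `hr`, the additive arguments of
both distributivities; the cocycle equations at zero arguments give the rest. -/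
theorem isNormalized_of_unital (hu : ∀ r, V.addRightUnit r = 0) (hv : ∀ r, V.addLeftUnit r = 0)
    (hl : ∀ r, V.leftDist r 0 0 = 0) (hr : ∀ s, V.rightDist 0 0 s = 0) :
    V.cochain.IsNormalized := by
  obtain ⟨a₁, a₂, a₃, a₄, a₅⟩ := V.interchange_eq_zero_of_unital hu hv
  have hc := V.isCocycle_cochain
  have l₂ : ∀ r s, V.leftDist r 0 s = 0 := fun r s =>
    (V.leftDist_zero_eq hu hv r 0 s).symm.trans (hl r)
  have l₃ : ∀ r s, V.leftDist r s 0 = 0 := fun r s =>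
    (V.leftDist_zero_eq hu hv r s 0).trans (hl r)
  have r₁ : ∀ r s, V.rightDist 0 r s = 0 := fun r s =>
    (V.rightDist_zero_eq hu hv 0 r s).symm.trans (hr s)
  have r₂ : ∀ r s, V.rightDist r 0 s = 0 := fun r s =>
    (V.rightDist_zero_eq hu hv r 0 s).trans (hr s)
  have l₁ : ∀ s t, V.leftDist 0 s t = 0 := fun s t => by
    have h := hc.eq₆ 0 0 s t
    change V.interchange _ _ _ _ = (V.rightDist _ _ _ + V.rightDist _ _ _ - V.rightDist _ _ _)
        - (V.leftDist _ _ _ + V.leftDist _ _ _ - V.leftDist _ _ _) at h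
    simpa [a₁, r₁] using h
  have r₃ : ∀ r s, V.rightDist r s 0 = 0 := fun r s => by
    have h := hc.eq₆ r s 0 0
    change V.interchange _ _ _ _ = (V.rightDist _ _ _ + V.rightDist _ _ _ - V.rightDist _ _ _)
        - (V.leftDist _ _ _ + V.leftDist _ _ _ - V.leftDist _ _ _) at h
    simpa [a₁, l₂] using h.symm
  have m₁ : ∀ s t, V.mulAss 0 s t = 0 := fun s t => by
    have h := hc.eq₄ 0 0 s t
    change V.rightDist _ _ _ - V.rightDist _ _ _ + V.rightDist _ _ _ <• _ =
      -(V.mulAss _ _ _ + V.mulAss _ _ _ - V.mulAss _ _ _) at h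
    simpa [r₁] using h
  have m₂ : ∀ s t, V.mulAss s 0 t = 0 := fun s t => by
    have h := hc.eq₃ s 0 0 t
    change V.leftDist _ _ _ - V.leftDist _ _ _ <• _ =
      V.rightDist _ _ _ - _ • V.rightDist _ _ _ +
        (V.mulAss _ _ _ + V.mulAss _ _ _ - V.mulAss _ _ _) at h
    simpa [r₁, l₂] using h.symm
  have m₃ : ∀ s t, V.mulAss s t 0 = 0 := fun s t => by
    have h := hc.eq₂ s t 0 0
    change _ • V.leftDist _ _ _ - V.leftDist _ _ _ + V.leftDist _ _ _ =
      V.mulAss _ _ _ + V.mulAss _ _ _ - V.mulAss _ _ _ at h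
    simpa [l₂] using h.symm
  exact ⟨m₁, m₂, m₃, l₁, l₂, l₃, r₁, r₂, r₃, a₁, a₂, a₃, a₄, a₅⟩

/-- Every valuation can be changed to one with a normalized cochain. -/
theorem exists_isNormalized (V : X.Valuation) : ∃ W : X.Valuation, W.cochain.IsNormalized := by
  classical
  obtain ⟨V, hu, hv⟩ : ∃ V : X.Valuation, (∀ r, V.addRightUnit r = 0) ∧
      (∀ r, V.addLeftUnit r = 0) := by
    -- The right units are corrected through `γa r 0` and the left ones through `γa 0 s`. At `(0,
    -- 0)` the two prescriptions agree because the unit constraints of `0` coincide.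
    refine ⟨V.modify 0 (fun r s => if s = 0 then - V.addRightUnit r else
      if r = 0 then - V.addLeftUnit s else 0), fun r => ?_, fun r => ?_⟩
    · simp [addRightUnit_modify]
    · rw [addLeftUnit_modify]
      by_cases h : r = 0
      · subst h
        simp [addLeftUnit_zero]
      · simp [h]
  -- This makes the two prescriptions for `γm 0 0` below compatible.
  have h₀ : V.leftDist 0 0 0 = V.rightDist 0 0 0 := by
    have h := V.isCocycle_cochain.eq₆ 0 0 0 0
    change V.interchange _ _ _ _ = (V.rightDist _ _ _ + V.rightDist _ _ _ - V.rightDist _ _ _)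
        - (V.leftDist _ _ _ + V.leftDist _ _ _ - V.leftDist _ _ _) at h
    simp only [mul_zero, add_zero, (V.interchange_eq_zero_of_unital hu hv).1] at h
    simpa using (sub_eq_zero.1 h.symm).symm
  -- The cross-effect of `γm r` at `(0, 0)` is `γm r 0`, so this choice cancels `leftDist r 0 0`,
  -- and symmetrically on the right. As `γa = 0`, the units stay trivial.
  refine ⟨V.modify (fun r s => if s = 0 then - V.leftDist r 0 0 else
      if r = 0 then - V.rightDist 0 0 s else 0) 0, isNormalized_of_unital _ (fun r => ?_)
      (fun r => ?_) (fun r => ?_) (fun s => ?_)⟩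
  · simp [addRightUnit_modify, hu]
  · simp [addLeftUnit_modify, hv]
  · simp [leftDist_modify]
  · rw [rightDist_modify]
    by_cases h : s = 0
    · subst h
      simp [h₀]
    · simp [h]

/-- A valuation with normalized cochain can be changed, without changing the cochain, so that the
additive unit constraints have constant value. -/
theorem exists_unital (hφ : V.cochain.IsNormalized) : ∃ W : X.Valuation, W.cochain = V.cochain ∧
    ∃ c, (∀ r, W.addRightUnit r = c) ∧ (∀ r, W.addLeftUnit r = c) := by
  have a₁ : ∀ r s, V.interchange r s 0 0 = 0 := hφ.a₁
  have a₂ : ∀ r s, V.interchange 0 r 0 s = 0 := hφ.a₄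
  have l₂ : ∀ r s, V.leftDist r 0 s = 0 := hφ.l₂
  have l₃ : ∀ r s, V.leftDist r s 0 = 0 := hφ.l₃
  have r₁ : ∀ r s, V.rightDist 0 r s = 0 := hφ.r₁
  have r₂ : ∀ r s, V.rightDist r 0 s = 0 := hφ.r₂
  have hz := V.addLeftUnit_zero
  -- Normalized distributivity vanishes when a summand is `0`, so associativity with middle argument
  -- `0` is equivariant.
  have hl : ∀ r s t, r • (V.addRightUnit s - V.addLeftUnit t) =
      V.addRightUnit (r * s) - V.addLeftUnit (r * t) := fun r s t => by
    have h := V.leftDist_addAssoc r s 0 t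
    simp only [add_zero, zero_add, mul_zero, l₂, l₃, addAssoc_zero_mid] at h
    linear_combination (norm := abel) -h
  have hr : ∀ r s t, (V.addRightUnit s - V.addLeftUnit t) <• r =
      V.addRightUnit (s * r) - V.addLeftUnit (t * r) := fun r s t => by
    have h := V.rightDist_addAssoc s 0 t r
    simp only [add_zero, zero_add, zero_mul, r₁, r₂, addAssoc_zero_mid] at h
    linear_combination (norm := abel) -h
  -- Vanishing of `φ_+` on matrices with zero second row makes the right unit values affine; zero
  -- first column does so for the left ones.
  have hu : ∀ r s, V.addRightUnit (r + s) =
      V.addRightUnit r + V.addRightUnit s - V.addRightUnit 0 := fun r s => by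
    have h := a₁ r s
    simp only [interchange, addAssoc_zero_mid, addAssoc_zero_left, addAssoc_zero_right,
      addSymm_zero_right, addSymm_zero_left, add_zero, hz] at h
    linear_combination (norm := abel_nf) h
  have hv : ∀ r s, V.addLeftUnit (r + s) =
      V.addLeftUnit r + V.addLeftUnit s - V.addLeftUnit 0 := fun r s => by
    have h := a₂ r s
    simp only [interchange, addAssoc_zero_mid, addAssoc_zero_left, addAssoc_zero_right,
      addSymm_zero_right, addSymm_zero_left, zero_add, hz] at h
    rw [hz]
    linear_combination (norm := abel) -h
  -- This `γa` is additive and compatible with both actions, so its coboundary vanishes. The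
  -- constant `addRightUnit 0` remains: a constant correction need not be equivariant and could
  -- change the distributivity components.
  refine ⟨V.modify 0 fun r s => V.addRightUnit 0 - V.addRightUnit r + V.addLeftUnit 0
    - V.addLeftUnit s, V.modify_cochain_eq (γm := 0) ⟨?_, ?_, ?_, ?_⟩, V.addRightUnit 0, ?_, ?_⟩
  · intro r s t
    simp only [sub_self]
    change (0 : B) = _
    simp
  · intro r s t
    simp only [sub_self]
    change (0 : B) = _
    have h₁ := hl r 0 t
    have h₂ := hl r s 0
    simp only [mul_zero] at h₁ h₂
    simp only [crossEffect, Pi.zero_apply, smul_add, smul_sub] at h₁ h₂ ⊢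
    rw [hz] at h₂ ⊢
    linear_combination (norm := abel) -h₁ + h₂
  · intro r s t
    simp only [sub_self]
    change (0 : B) = _
    have h₁ := hr t 0 s
    have h₂ := hr t r 0
    simp only [zero_mul] at h₁ h₂
    simp only [crossEffect, Pi.zero_apply, smul_add, smul_sub] at h₁ h₂ ⊢
    rw [hz] at h₂ ⊢
    linear_combination (norm := abel) -h₁ + h₂
  · intro w x y z
    simp only [sub_self]
    change (0 : B) = _
    simp only [crossEffect, Prod.mk_add_mk, hu, hv]
    abel
  · intro r
    rw [addRightUnit_modify]
    abel
  · intro r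
    rw [addLeftUnit_modify, hz]
    abel

/-- With constant units all other terms of the interchange cancel. This is why the skeletal
associativity is `φ_+` at `r, s, 0, t`. -/
theorem addAssoc_eq_interchange {c : B} (hu : ∀ r, V.addRightUnit r = c)
    (hv : ∀ r, V.addLeftUnit r = c) (r s t : R) :
    V.addAssoc r s t = V.interchange r s 0 t := by
  simp [interchange, addAssoc_zero_mid, addAssoc_zero_left, addAssoc_zero_right,
    addSymm_zero_right, addSymm_zero_left, hu, hv]

/-! ### Characteristic cochains -/

/-- The cochain of a valuation is characteristic. -/
theorem isCharacteristic_cochain : X.IsCharacteristic V.cochain := by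
  -- With these values of `σm` and `σa`, the terms contributed by `κ` and `ν` become exactly the
  -- corrections defining the cochain.
  refine ⟨X.rep, X.cls_rep, fun r s => V.homOf (y := X.rep (r * s))
    (by simp only [X.cls_mul, X.cls_rep]) (- V.ν (X.rep r) (X.rep s)),
    fun r s => V.homOf (y := X.rep (r + s))
    (by simp only [X.cls_tensor, X.cls_rep]) (- V.κ (X.rep r) (X.rep s)), ?_, ?_, ?_, ?_⟩
  · intro r s t
    apply V.val_injective
    have h := V.mulAss_cls (X.rep r) (X.rep s) (X.rep t)
    simp only [X.cls_rep] at h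
    simp only [V.val_comp, V.val_mulHom, val_shift, val_homOf, val_id, val_eqToHom, smul_zero,
      X.cls_rep, smul_neg]
    linear_combination (norm := (simp only [Quadruple.m, cochain]; abel)) -h
  · intro r s t
    apply V.val_injective
    have h := V.leftDist_cls (X.rep r) (X.rep s) (X.rep t)
    simp only [X.cls_rep] at h
    simp only [V.val_comp, V.val_mulHom, V.val_tensorHom, val_shift, val_homOf, val_id,
      val_eqToHom, smul_zero, X.cls_rep, smul_neg]
    linear_combination (norm := (simp only [Quadruple.l, cochain]; abel)) -h
  · intro r s t
    apply V.val_injective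
    have h := V.rightDist_cls (X.rep r) (X.rep s) (X.rep t)
    simp only [X.cls_rep] at h
    simp only [V.val_comp, V.val_mulHom, V.val_tensorHom, val_shift, val_homOf, val_id,
      val_eqToHom, smul_zero, X.cls_rep, smul_neg]
    linear_combination (norm := (simp only [Quadruple.r, cochain]; abel)) -h
  · intro w x y z
    apply V.val_injective
    have h := V.interchange_cls (X.rep w) (X.rep x) (X.rep y) (X.rep z)
    simp only [X.cls_rep] at h
    simp only [V.val_comp, V.val_tensorHom, val_shift, val_homOf, val_id, val_eqToHom]
    linear_combination (norm := (simp only [Quadruple.a, cochain]; abel)) -h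

/-- Every characteristic cochain is the cochain of a valuation. -/
theorem exists_cochain_eq (V : X.Valuation) {φ : Quadruple R B} (hφ : X.IsCharacteristic φ) :
    ∃ W : X.Valuation, W.cochain = φ := by
  obtain ⟨obj, hobj, σm, σa, hm, hl, hr, ha⟩ := hφ
  change ∀ r, X.cls (obj r) = r at hobj
  -- The modification is chosen so that on the objects `obj r` the new `ν` and `κ` are the negatives
  -- of the values of `σm` and `σa`.
  refine ⟨V.modify (fun r s => V.ν (obj r) (obj s) + V.val (σm r s))
    (fun r s => - V.κ (obj r) (obj s) - V.val (σa r s)), Prod.ext ?_ (Prod.ext ?_ (Prod.ext ?_ ?_))⟩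
  · funext r s t
    have h := congrArg V.val (hm r s t)
    simp only [V.val_comp, V.val_mulHom, val_shift, val_id, val_eqToHom, smul_zero, hobj] at h
    have h' := V.mulAss_cls (obj r) (obj s) (obj t)
    simp only [hobj] at h'
    change mulAss _ r s t = φ.m r s t
    rw [mulAss_modify, h']
    simp only [smul_add]
    linear_combination (norm := abel) h
  · funext r s t
    have h := congrArg V.val (hl r s t)
    simp only [V.val_comp, V.val_mulHom, V.val_tensorHom, val_shift, val_id, val_eqToHom,
      smul_zero, hobj] at h
    have h' := V.leftDist_cls (obj r) (obj s) (obj t)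
    simp only [hobj] at h'
    change leftDist _ r s t = φ.l r s t
    rw [leftDist_modify, h']
    simp only [smul_add, smul_sub, smul_neg]
    linear_combination (norm := abel) h
  · funext r s t
    have h := congrArg V.val (hr r s t)
    simp only [V.val_comp, V.val_mulHom, V.val_tensorHom, val_shift, val_id, val_eqToHom,
      smul_zero, hobj] at h
    have h' := V.rightDist_cls (obj r) (obj s) (obj t)
    simp only [hobj] at h'
    change rightDist _ r s t = φ.r r s t
    rw [rightDist_modify, h']
    simp only [smul_add, smul_sub, smul_neg]
    linear_combination (norm := abel) h
  · funext w x y z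
    have h := congrArg V.val (ha w x y z)
    simp only [V.val_comp, V.val_tensorHom, val_shift, val_id, val_eqToHom] at h
    have h' := V.interchange_cls (obj w) (obj x) (obj y) (obj z)
    simp only [hobj] at h'
    change interchange _ w x y z = φ.a w x y z
    rw [interchange_modify, h']
    linear_combination (norm := abel) h

end CrossedExtension.Valuation

/-! ### Lax monoidal functors for the multiplication -/

section MulLax

variable {C D : Type u} [Category.{v} C] [Category.{v} D] [MulStructure C] [MulStructure D]
  {F : C ⥤ D}

/-- A lax monoidal structure for the multiplication. -/
@[reducible] def mulLaxMonoidal (ε : oneObj D ⟶ F.obj (oneObj C))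
    (μ : ∀ x y : C, F.obj x ⊙ F.obj y ⟶ F.obj (x ⊙ y))
    (natural : ∀ {x x' y y' : C} (f : x ⟶ x') (g : y ⟶ y'),
      (F.map f ⊙ₘ F.map g) ≫ μ x' y' = μ x y ≫ F.map (f ⊙ₘ g))
    (assoc : ∀ x y z : C, (μ x y ⊙ₘ 𝟙 (F.obj z)) ≫ μ (x ⊙ y) z ≫ F.map (mulAssoc x y z).hom =
      (mulAssoc (F.obj x) (F.obj y) (F.obj z)).hom ≫ (𝟙 (F.obj x) ⊙ₘ μ y z) ≫ μ x (y ⊙ z))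
    (left : ∀ x : C, (oneMul (F.obj x)).hom =
      (ε ⊙ₘ 𝟙 (F.obj x)) ≫ μ (oneObj C) x ≫ F.map (oneMul x).hom)
    (right : ∀ x : C, (mulOne (F.obj x)).hom =
      (𝟙 (F.obj x) ⊙ₘ ε) ≫ μ x (oneObj C) ≫ F.map (mulOne x).hom) :
    @Functor.LaxMonoidal C _ MulStructure.mon D _ MulStructure.mon F :=
  letI := MulStructure.mon (C := C)
  letI := MulStructure.mon (C := D)
  Functor.LaxMonoidal.ofTensorHom ε μ natural assoc left right

variable (h : @Functor.LaxMonoidal C _ MulStructure.mon D _ MulStructure.mon F)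

/-- The structure morphism of a lax monoidal structure for the multiplication. -/
def mulMap (x y : C) : F.obj x ⊙ F.obj y ⟶ F.obj (x ⊙ y) :=
  @Functor.LaxMonoidal.μ C _ MulStructure.mon D _ MulStructure.mon F h x y

theorem mulMap_natural {x x' y y' : C} (f : x ⟶ x') (g : y ⟶ y') :
    (F.map f ⊙ₘ F.map g) ≫ mulMap h x' y' = mulMap h x y ≫ F.map (f ⊙ₘ g) :=
  @Functor.LaxMonoidal.μ_natural C _ MulStructure.mon D _ MulStructure.mon F h _ _ _ _ f g

theorem mulMap_assoc (x y z : C) :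
    (mulMap h x y ⊙ₘ 𝟙 (F.obj z)) ≫ mulMap h (x ⊙ y) z ≫ F.map (mulAssoc x y z).hom =
      (mulAssoc (F.obj x) (F.obj y) (F.obj z)).hom ≫ (𝟙 (F.obj x) ⊙ₘ mulMap h y z) ≫
        mulMap h x (y ⊙ z) := by
  let _ := MulStructure.mon (C := C)
  let _ := MulStructure.mon (C := D)
  have e := h.associativity x y z
  rw [← MonoidalCategory.tensorHom_id, ← MonoidalCategory.id_tensorHom] at e
  exact e

end MulLax

namespace CrossedExtension.Valuation

variable {R : Type u} [Ring R] {B : Type v} [AddCommGroup B] [Module R B] [Module Rᵐᵒᵖ B]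
  [SMulCommClass R Rᵐᵒᵖ B] {X Y : CrossedExtension R B}

/-! ### Valuations and 2-homomorphisms -/

/-- The pullback of a valuation along a 2-homomorphism that is the identity on `π₀` and `π₁`. -/
def pullback (W : Y.Valuation) (f : TwoHom X.C Y.C)
    (h₀ : ∀ x : X.C, Y.cls (f.F.obj x) = X.cls x)
    (h₁ : ∀ β : 𝟙_ X.C ⟶ 𝟙_ X.C,
      Y.pi1 (f.addMonoidal.ε ≫ f.F.map β ≫ inv f.addMonoidal.ε) = X.pi1 β) : X.Valuation where
  val g := W.val (f.F.map g)
  κ x y := W.κ (f.F.obj x) (f.F.obj y) + W.val (f.addMonoidal.μ x y)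
  ν x y := W.ν (f.F.obj x) (f.F.obj y) + W.val (mulMap f.mulMonoidal x y)
  val_comp g h := by rw [f.F.map_comp, W.val_comp]
  val_unit β := by
    rw [← h₁, ← W.val_unit]
    simp only [W.val_comp, val_inv]
    abel
  val_tensorHom g h := by
    let _ := f.addMonoidal
    have e := congrArg W.val (Functor.LaxMonoidal.μ_natural f.F g h)
    simp only [W.val_comp, W.val_tensorHom] at e
    linear_combination (norm := abel) -e
  val_mulHom {x x' y y'} g h := by
    have e' := congrArg W.val (mulMap_natural f.mulMonoidal g h)
    simp only [W.val_comp, W.val_mulHom, h₀] at e'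
    linear_combination (norm := abel) -e'

/-- The pullback of a valuation has the same cochain. -/
theorem cochain_pullback (W : Y.Valuation) (f : TwoHom X.C Y.C)
    (h₀ : ∀ x : X.C, Y.cls (f.F.obj x) = X.cls x)
    (h₁ : ∀ β : 𝟙_ X.C ⟶ 𝟙_ X.C,
      Y.pi1 (f.addMonoidal.ε ≫ f.F.map β ≫ inv f.addMonoidal.ε) = X.pi1 β) :
    (W.pullback f h₀ h₁).cochain = W.cochain := by
  have hm : ∀ r s t, (W.pullback f h₀ h₁).mulAss r s t = W.mulAss r s t := fun r s t => by
    obtain ⟨x, rfl⟩ := X.exists_cls r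
    obtain ⟨y, rfl⟩ := X.exists_cls s
    obtain ⟨z, rfl⟩ := X.exists_cls t
    have e' := congrArg W.val (mulMap_assoc f.mulMonoidal x y z)
    simp only [W.val_comp, W.val_mulHom, h₀, val_id, smul_zero] at e'
    rw [mulAss_cls, ← h₀ x, ← h₀ y, ← h₀ z, mulAss_cls]
    simp only [pullback, h₀, smul_add]
    linear_combination (norm := abel) e'
  have hl : ∀ r s t, (W.pullback f h₀ h₁).leftDist r s t = W.leftDist r s t := fun r s t => by
    obtain ⟨x, rfl⟩ := X.exists_cls r
    obtain ⟨y, rfl⟩ := X.exists_cls s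
    obtain ⟨z, rfl⟩ := X.exists_cls t
    have e₀ : ldis (f.F.obj x) (f.F.obj y) (f.F.obj z) ≫
        (mulMap f.mulMonoidal x y ⊗ₘ mulMap f.mulMonoidal x z) ≫
          f.addMonoidal.μ (x ⊙ y) (x ⊙ z) = (𝟙 (f.F.obj x) ⊙ₘ f.addMonoidal.μ y z) ≫
            mulMap f.mulMonoidal x (y ⊗ z) ≫ f.F.map (ldis x y z) := f.ldis_comp x y z
    have e := congrArg W.val e₀
    simp only [W.val_comp, W.val_mulHom, W.val_tensorHom, h₀, val_id, smul_zero] at e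
    rw [leftDist_cls, ← h₀ x, ← h₀ y, ← h₀ z, leftDist_cls]
    simp only [pullback, h₀, smul_add]
    linear_combination (norm := abel) -e
  have hr : ∀ r s t, (W.pullback f h₀ h₁).rightDist r s t = W.rightDist r s t := fun r s t => by
    obtain ⟨x, rfl⟩ := X.exists_cls r
    obtain ⟨y, rfl⟩ := X.exists_cls s
    obtain ⟨z, rfl⟩ := X.exists_cls t
    have e₀ : rdis (f.F.obj x) (f.F.obj y) (f.F.obj z) ≫
        (mulMap f.mulMonoidal x z ⊗ₘ mulMap f.mulMonoidal y z) ≫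
          f.addMonoidal.μ (x ⊙ z) (y ⊙ z) = (f.addMonoidal.μ x y ⊙ₘ 𝟙 (f.F.obj z)) ≫
            mulMap f.mulMonoidal (x ⊗ y) z ≫ f.F.map (rdis x y z) := f.rdis_comp x y z
    have e := congrArg W.val e₀
    simp only [W.val_comp, W.val_mulHom, W.val_tensorHom, h₀, val_id, smul_zero] at e
    rw [rightDist_cls, ← h₀ x, ← h₀ y, ← h₀ z, rightDist_cls]
    simp only [pullback, h₀, smul_add]
    linear_combination (norm := abel) -e
  have hA : ∀ r s t, (W.pullback f h₀ h₁).addAssoc r s t = W.addAssoc r s t := fun r s t => by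
    obtain ⟨x, rfl⟩ := X.exists_cls r
    obtain ⟨y, rfl⟩ := X.exists_cls s
    obtain ⟨z, rfl⟩ := X.exists_cls t
    let _ := f.addMonoidal
    have e := congrArg W.val (Functor.LaxMonoidal.associativity f.F x y z)
    simp only [W.val_comp, val_whiskerLeft, val_whiskerRight] at e
    rw [addAssoc_cls, ← h₀ x, ← h₀ y, ← h₀ z, addAssoc_cls]
    simp only [pullback]
    linear_combination (norm := abel) e
  -- the symmetry is determined by associativity and distributivity
  have hS : ∀ r s, (W.pullback f h₀ h₁).addSymm r s = W.addSymm r s := fun r s => by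
    -- Distributing `(1 + 1)(s + r)` in two ways yields the interchange at `s, r, s, r`, whose only
    -- symmetry term is `addSymm r s`; everything else is already known to agree.
    have e₁ := (W.pullback f h₀ h₁).isCocycle_cochain.eq₆ 1 1 s r
    have e₂ := W.isCocycle_cochain.eq₆ 1 1 s r
    change interchange _ _ _ _ _ = (rightDist _ _ _ _ + rightDist _ _ _ _ - rightDist _ _ _ _)
        - (leftDist _ _ _ _ + leftDist _ _ _ _ - leftDist _ _ _ _) at e₁ e₂
    simp only [hl, hr] at e₁
    rw [← e₂] at e₁
    simp only [interchange, hA, one_mul] at e₁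
    linear_combination (norm := abel) e₁
  refine Prod.ext ?_ (Prod.ext ?_ (Prod.ext ?_ ?_))
  · funext r s t; exact hm r s t
  · funext r s t; exact hl r s t
  · funext r s t; exact hr r s t
  · funext w x y z
    change interchange _ _ _ _ _ = interchange _ _ _ _ _
    simp only [interchange, hA, hS]

/-- Related extensions share cochains, which is the invariance of the characteristic class. -/
theorem exists_of_rel (h : X.Rel Y) (W : Y.Valuation) :
    ∃ V : X.Valuation, V.cochain = W.cochain := by
  obtain ⟨f, h₀, h₁⟩ := h
  exact ⟨_, W.cochain_pullback f h₀ h₁⟩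

/-! ### Value-preserving functors -/

section Transfer

variable (V : X.Valuation) (W : Y.Valuation)

/-- The functor that preserves values and maps to chosen objects. -/
noncomputable def functor : X.C ⥤ Y.C where
  obj x := Y.rep (X.cls x)
  map f := W.homOf (congrArg (fun r => Y.cls (Y.rep r)) (X.cls_eq f)) (V.val f)
  map_id x := W.val_injective (by simp)
  map_comp f g := W.val_injective (by simp [V.val_comp, W.val_comp])

theorem val_functor_map {x y : X.C} (f : x ⟶ y) : W.val ((V.functor W).map f) = V.val f :=
  W.val_homOf (congrArg (fun r => Y.cls (Y.rep r)) (X.cls_eq f)) _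

variable {V W} {F : X.C ⥤ Y.C}

/-- A functor that preserves classes and values is monoidal for the addition. -/
theorem exists_laxMonoidal (hF : ∀ x, Y.cls (F.obj x) = X.cls x)
    (hFm : ∀ {x y : X.C} (f : x ⟶ y), W.val (F.map f) = V.val f) {c d : B}
    (hA : ∀ r s t, V.addAssoc r s t = W.addAssoc r s t)
    (hu : ∀ r, V.addRightUnit r = c) (hv : ∀ r, V.addLeftUnit r = c)
    (hu' : ∀ r, W.addRightUnit r = d) (hv' : ∀ r, W.addLeftUnit r = d) :
    ∃ a : F.LaxMonoidal, ∀ x y, W.val (a.μ x y) = V.κ x y - W.κ (F.obj x) (F.obj y) := by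
  refine ⟨{
    -- The value `d - c` compensates the two unit constants; one morphism serves for all objects
    -- because the units are constant.
    ε := W.homOf (by rw [hF, X.cls_unit, Y.cls_unit]) (d - c)
    -- This value makes the `κ` of `V` the pullback of that of `W`.
    μ := fun x y => W.homOf (by rw [hF, X.cls_tensor, Y.cls_tensor, hF, hF])
      (V.κ x y - W.κ (F.obj x) (F.obj y))
    μ_natural_left := ?_
    μ_natural_right := ?_
    associativity := ?_
    left_unitality := ?_
    right_unitality := ?_ }, fun x y => W.val_homOf _ _⟩
  · intro x y f z
    apply W.val_injective
    simp only [W.val_comp, val_whiskerRight, val_homOf, hFm]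
    abel
  · intro x y z f
    apply W.val_injective
    simp only [W.val_comp, val_whiskerLeft, val_homOf, hFm]
    abel
  · intro x y z
    apply W.val_injective
    have h₁ := V.addAssoc_cls x y z
    have h₂ := W.addAssoc_cls (F.obj x) (F.obj y) (F.obj z)
    simp only [hF] at h₂
    rw [hA, h₂] at h₁
    simp only [W.val_comp, val_whiskerLeft, val_whiskerRight, val_homOf, hFm]
    linear_combination (norm := abel) -h₁
  · intro x
    apply W.val_injective
    have h₁ := V.addLeftUnit_cls x
    have h₂ := W.addLeftUnit_cls (F.obj x)
    rw [hv] at h₁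
    rw [hv'] at h₂
    simp only [W.val_comp, val_whiskerRight, val_homOf, hFm]
    linear_combination (norm := abel) h₁ - h₂
  · intro x
    apply W.val_injective
    have h₁ := V.addRightUnit_cls x
    have h₂ := W.addRightUnit_cls (F.obj x)
    rw [hu] at h₁
    rw [hu'] at h₂
    simp only [W.val_comp, val_whiskerLeft, val_homOf, hFm]
    linear_combination (norm := abel) h₁ - h₂

end Transfer

end CrossedExtension.Valuation

/-! ### Classification of crossed extensions by their cochains -/

namespace CrossedExtension

variable {R : Type u} [Ring R] {B : Type v} [AddCommGroup B] [Module R B] [Module Rᵐᵒᵖ B]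
  [SMulCommClass R Rᵐᵒᵖ B] {X Y : CrossedExtension R B}

/-- Crossed extensions with valuations of the same normalized cochain are related. -/
theorem rel_of_cochain_eq {V : X.Valuation} {W : Y.Valuation} (hV : V.cochain.IsNormalized)
    (h : V.cochain = W.cochain) : X.Rel Y := by
  obtain ⟨V', hV', c, hu, hv⟩ := V.exists_unital hV
  obtain ⟨W', hW', d, hu', hv'⟩ := W.exists_unital (h ▸ hV)
  have e : V'.cochain = W'.cochain := by rw [hV', hW', h]
  clear hV h hV' hW' V W
  have hm : ∀ r s t, V'.mulAss r s t = W'.mulAss r s t := fun r s t =>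
    congrFun (congrFun (congrFun (congrArg Quadruple.m e) r) s) t
  have hl : ∀ r s t, V'.leftDist r s t = W'.leftDist r s t := fun r s t =>
    congrFun (congrFun (congrFun (congrArg Quadruple.l e) r) s) t
  have hr : ∀ r s t, V'.rightDist r s t = W'.rightDist r s t := fun r s t =>
    congrFun (congrFun (congrFun (congrArg Quadruple.r e) r) s) t
  have ha : ∀ w x y z, V'.interchange w x y z = W'.interchange w x y z := fun w x y z =>
    congrFun (congrFun (congrFun (congrFun (congrArg Quadruple.a e) w) x) y) z
  have hA : ∀ r s t, V'.addAssoc r s t = W'.addAssoc r s t := fun r s t => by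
    rw [V'.addAssoc_eq_interchange hu hv, W'.addAssoc_eq_interchange hu' hv', ha]
  -- Equal multiplicative associativities at `1, 1, r` (and at `r, 1, 1` for `hq`) show that the
  -- multiplicative units differ by the action on a single element, their difference at `1`. It will
  -- be the value of `ε`.
  have hp : ∀ r, W'.mulLeftUnit r - V'.mulLeftUnit r =
      (W'.mulRightUnit 1 - V'.mulRightUnit 1) <• r := fun r => by
    have h₁ := V'.mulAss_one_mid 1 r
    have h₂ := W'.mulAss_one_mid 1 r
    rw [hm, h₂, one_smul, one_smul] at h₁
    rw [smul_sub]
    linear_combination (norm := abel) -h₁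
  have hq : ∀ r, W'.mulRightUnit r - V'.mulRightUnit r =
      r • (W'.mulRightUnit 1 - V'.mulRightUnit 1) := fun r => by
    have h₁ := V'.mulAss_one_mid r 1
    have h₂ := W'.mulAss_one_mid r 1
    rw [hm, h₂, MulOpposite.op_one, one_smul, one_smul, V'.mulLeftUnit_one,
      W'.mulLeftUnit_one] at h₁
    rw [smul_sub]
    linear_combination (norm := abel) h₁
  obtain ⟨F, hF, hFm⟩ : ∃ F : X.C ⥤ Y.C, (∀ x, Y.cls (F.obj x) = X.cls x) ∧
      ∀ {x y : X.C} (f : x ⟶ y), W'.val (F.map f) = V'.val f :=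
    ⟨V'.functor W', fun _ => Y.cls_rep _, V'.val_functor_map W'⟩
  obtain ⟨a, ha⟩ := Valuation.exists_laxMonoidal hF hFm hA hu hv hu' hv'
  obtain ⟨μ, hμ⟩ : ∃ μ : ∀ x y : X.C, F.obj x ⊙ F.obj y ⟶ F.obj (x ⊙ y),
      ∀ x y, W'.val (μ x y) = V'.ν x y - W'.ν (F.obj x) (F.obj y) :=
    ⟨fun x y => W'.homOf (by rw [hF, X.cls_mul, Y.cls_mul, hF, hF]) _, fun _ _ => W'.val_homOf _ _⟩
  have hldis : ∀ r s₀ s₁ : X.C, ldis (F.obj r) (F.obj s₀) (F.obj s₁) ≫ (μ r s₀ ⊗ₘ μ r s₁) ≫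
      a.μ (r ⊙ s₀) (r ⊙ s₁) =
        (𝟙 (F.obj r) ⊙ₘ a.μ s₀ s₁) ≫ μ r (s₀ ⊗ s₁) ≫ F.map (ldis r s₀ s₁) := by
    intro r s₀ s₁
    apply W'.val_injective
    have h₁ := V'.leftDist_cls r s₀ s₁
    have h₂ := W'.leftDist_cls (F.obj r) (F.obj s₀) (F.obj s₁)
    simp only [hF] at h₂
    rw [hl, h₂] at h₁
    simp only [W'.val_comp, W'.val_mulHom, W'.val_tensorHom, ha, hμ, hFm, hF,
      Valuation.val_id, smul_zero, smul_sub]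
    linear_combination (norm := abel) h₁
  have hrdis : ∀ r₀ r₁ s : X.C, rdis (F.obj r₀) (F.obj r₁) (F.obj s) ≫ (μ r₀ s ⊗ₘ μ r₁ s) ≫
      a.μ (r₀ ⊙ s) (r₁ ⊙ s) =
        (a.μ r₀ r₁ ⊙ₘ 𝟙 (F.obj s)) ≫ μ (r₀ ⊗ r₁) s ≫ F.map (rdis r₀ r₁ s) := by
    intro r₀ r₁ s
    apply W'.val_injective
    have h₁ := V'.rightDist_cls r₀ r₁ s
    have h₂ := W'.rightDist_cls (F.obj r₀) (F.obj r₁) (F.obj s)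
    simp only [hF] at h₂
    rw [hr, h₂] at h₁
    simp only [W'.val_comp, W'.val_mulHom, W'.val_tensorHom, ha, hμ, hFm, hF,
      Valuation.val_id, smul_zero, smul_sub]
    linear_combination (norm := abel) h₁
  refine ⟨⟨F, a, mulLaxMonoidal
    (W'.homOf (by rw [hF, X.cls_one, Y.cls_one]) (W'.mulRightUnit 1 - V'.mulRightUnit 1))
    μ ?_ ?_ ?_ ?_, hldis, hrdis⟩, hF, ?_⟩
  · intro x x' y y' f g
    apply W'.val_injective
    simp only [W'.val_comp, V'.val_mulHom, W'.val_mulHom, hμ, Valuation.val_homOf, hFm, hF]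
    abel
  · intro x y z
    apply W'.val_injective
    have h₁ := V'.mulAss_cls x y z
    have h₂ := W'.mulAss_cls (F.obj x) (F.obj y) (F.obj z)
    simp only [hF] at h₂
    rw [hm, h₂] at h₁
    simp only [W'.val_comp, W'.val_mulHom, hμ, Valuation.val_homOf, hFm, hF, Valuation.val_id,
      smul_zero, smul_sub]
    linear_combination (norm := abel) -h₁
  · intro x
    apply W'.val_injective
    have h₁ := V'.mulLeftUnit_cls x
    have h₂ := W'.mulLeftUnit_cls (F.obj x)
    have h₃ := hp (X.cls x)
    rw [hF] at h₂
    simp only [W'.val_comp, W'.val_mulHom, hμ, Valuation.val_homOf, hFm, hF, Valuation.val_id,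
      smul_zero]
    linear_combination (norm := abel) h₁ - h₂ + h₃
  · intro x
    apply W'.val_injective
    have h₁ := V'.mulRightUnit_cls x
    have h₂ := W'.mulRightUnit_cls (F.obj x)
    have h₃ := hq (X.cls x)
    rw [hF] at h₂
    simp only [W'.val_comp, W'.val_mulHom, hμ, Valuation.val_homOf, hFm, hF, Valuation.val_id,
      smul_zero]
    linear_combination (norm := abel) h₁ - h₂ + h₃
  -- Conjugation by `ε` does not affect values, and on automorphisms of `0` the values are the given
  -- identification of `π₁`.
  · intro β
    rw [← W'.val_unit, ← V'.val_unit]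
    simp only [W'.val_comp, Valuation.val_inv, hFm]
    abel

/-- Being connected by a 2-homomorphism is an equivalence relation. -/
theorem rel_equivalence : _root_.Equivalence (Rel (R := R) (B := B)) := by
  -- 2-homomorphisms are neither composed nor inverted: cochains are carried along them, and a new
  -- one is built from the equality of cochains.
  have key : ∀ X : CrossedExtension R B, ∃ V : X.Valuation, V.cochain.IsNormalized := fun X =>
    X.nonempty_valuation.elim Valuation.exists_isNormalized
  refine ⟨fun X => ?_, fun {X Y} h => ?_, fun {X Y Z} h h' => ?_⟩
  · obtain ⟨V, hV⟩ := key X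
    exact rel_of_cochain_eq hV rfl
  · obtain ⟨W, hW⟩ := key Y
    obtain ⟨V, hV⟩ := Valuation.exists_of_rel h W
    exact rel_of_cochain_eq hW hV.symm
  · obtain ⟨W, hW⟩ := key Z
    obtain ⟨V, hV⟩ := Valuation.exists_of_rel h' W
    obtain ⟨U, hU⟩ := Valuation.exists_of_rel h V
    rw [← hV, ← hU] at hW
    exact rel_of_cochain_eq hW (hU.trans hV)

end CrossedExtension

/-! ### The skeletal categorical ring -/

section SkeletalValuation

variable {R : Type u} [Ring R] {B : Type v} [AddCommGroup B] [Module R B] [Module Rᵐᵒᵖ B]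
  [SMulCommClass R Rᵐᵒᵖ B]

/-- The valuation of the skeletal categorical ring. -/
def skeletalValuation (φ : Z3 R B) : (skeletal φ).Valuation where
  val f := SkelHom.val f
  -- In the skeletal ring sum and product of morphisms are given on `B`-components by the
  -- uncorrected formulas.
  κ _ _ := 0
  ν _ _ := 0
  val_comp _ _ := rfl
  val_unit _ := rfl
  val_tensorHom f g := by
    rw [add_zero, sub_zero]
    rfl
  val_mulHom f g := by
    rw [add_zero, sub_zero]
    rfl

/-- An element of `R` as an object of the skeletal categorical ring. -/
def skeletalObj (φ : Z3 R B) (r : R) : (skeletal φ).C := r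

/-- Without corrections the cochain consists of the `B`-components of the constraints. Only
interchange needs an argument, `Skel.tensorμ_val`, which rests on equation 8. -/
theorem skeletalValuation_cochain (φ : Z3 R B) : (skeletalValuation φ).cochain = φ.1.1 := by
  refine Prod.ext ?_ (Prod.ext ?_ (Prod.ext ?_ ?_))
  · funext r s t
    refine ((skeletalValuation φ).mulAss_cls (skeletalObj φ r) (skeletalObj φ s) (skeletalObj φ t)).trans ?_
    change (0 : B) <• _ + 0 + φ.1.1.m r s t - _ • (0 : B) - 0 = φ.1.1.m r s t
    simp
  · funext r s t
    refine ((skeletalValuation φ).leftDist_cls (skeletalObj φ r) (skeletalObj φ s) (skeletalObj φ t)).trans ?_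
    change _ • (0 : B) + 0 + φ.1.1.l r s t - 0 - 0 - 0 = φ.1.1.l r s t
    simp
  · funext r s t
    refine ((skeletalValuation φ).rightDist_cls (skeletalObj φ r) (skeletalObj φ s) (skeletalObj φ t)).trans ?_
    change (0 : B) <• _ + 0 + φ.1.1.r r s t - 0 - 0 - 0 = φ.1.1.r r s t
    simp
  · funext w x y z
    refine ((skeletalValuation φ).interchange_cls (skeletalObj φ w) (skeletalObj φ x) (skeletalObj φ y)
      (skeletalObj φ z)).trans ?_
    have h : (skeletalValuation φ).val (tensorμ (skeletalObj φ w) (skeletalObj φ x) (skeletalObj φ y)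
      (skeletalObj φ z)) = φ.1.1.a w x y z := Skel.tensorμ_val (φ := φ) (w : R) x y z
    refine (congrArg (fun b : B => 0 + 0 + 0 + b - 0 - 0 - 0) h).trans ?_
    simp only [add_zero, zero_add, sub_zero]
    rfl

/-- Every valuation of a skeletal categorical ring is a modification of the standard one. -/
theorem exists_eq_modify_skeletalValuation (φ : Z3 R B) (V : (skeletal φ).Valuation) :
    ∃ γm γa : R → R → B, V.cochain = ((skeletalValuation φ).modify γm γa).cochain := by
  have hval : ∀ {x y : (skeletal φ).C} (f : x ⟶ y), V.val f = (skeletalValuation φ).val f := by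
    intro x y f
    -- All morphisms are automorphisms, hence shifts, whose value is the same for every valuation.
    -- Only `κ` and `ν` can vary.
    obtain rfl : x = y := Skel.el_eq (φ := φ) (r := x) (s := y) f
    obtain ⟨b, rfl⟩ := CrossedExtension.exists_aut_eq (skeletal φ) f
    simp only [CrossedExtension.Valuation.val_aut]
  refine ⟨fun (r s : R) => - V.ν (skeletalObj φ r) (skeletalObj φ s), fun (r s : R) => V.κ (skeletalObj φ r) (skeletalObj φ s),
    congrArg CrossedExtension.Valuation.cochain ?_⟩
  have hκ : V.κ = ((skeletalValuation φ).modify (fun (r s : R) => - V.ν (skeletalObj φ r) (skeletalObj φ s))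
      fun (r s : R) => V.κ (skeletalObj φ r) (skeletalObj φ s)).κ := by
    funext x y
    exact (zero_add _).symm
  have hν : V.ν = ((skeletalValuation φ).modify (fun (r s : R) => - V.ν (skeletalObj φ r) (skeletalObj φ s))
      fun (r s : R) => V.κ (skeletalObj φ r) (skeletalObj φ s)).ν := by
    funext x y
    exact ((sub_neg_eq_add (0 : B) _).trans (zero_add _)).symm
  generalize hW : (skeletalValuation φ).modify (fun (r s : R) => - V.ν (skeletalObj φ r) (skeletalObj φ s))
      (fun (r s : R) => V.κ (skeletalObj φ r) (skeletalObj φ s)) = W at hκ hν ⊢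
  have hval' : @V.val = @W.val := by
    funext x y f
    rw [hval, ← hW]
    rfl
  cases V
  cases W
  simp only at hκ hν hval'
  subst hκ hν hval'
  rfl

/-- Forwards, the standard valuation for `ψ` pulls back to a modification of the one for `φ`, so the
cocycles differ by a coboundary. Backwards, modifying the valuation for `φ` by the given `γ`
realizes `ψ` as a cochain of the skeletal ring of `φ`. -/
theorem rel_skeletal_iff (φ ψ : Z3 R B) :
    (skeletal φ).Rel (skeletal ψ) ↔ ψ.1 - φ.1 ∈ B3 R B := by
  constructor
  · intro h
    obtain ⟨V, hV⟩ := CrossedExtension.Valuation.exists_of_rel h (skeletalValuation ψ)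
    obtain ⟨γm, γa, e⟩ := exists_eq_modify_skeletalValuation φ V
    refine ⟨γm, γa, ?_⟩
    have h' := (skeletalValuation φ).isCoboundaryOf_modify γm γa
    rw [← e, hV, skeletalValuation_cochain, skeletalValuation_cochain] at h'
    exact h'
  · rintro ⟨γm, γa, h⟩
    refine CrossedExtension.rel_of_cochain_eq (V := (skeletalValuation φ).modify γm γa)
      (W := skeletalValuation ψ) ?_ ?_
    all_goals rw [(skeletalValuation φ).modify_cochain_eq (φ := ψ.1.1)
      (by rw [skeletalValuation_cochain]; exact h)]
    · exact ψ.1.2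
    · rw [skeletalValuation_cochain]

end SkeletalValuation

/-! ### The bijection -/

theorem theorem1 (R : Type u) [Ring R] (B : Type v) [AddCommGroup B] [Module R B] [Module Rᵐᵒᵖ B]
    [SMulCommClass R Rᵐᵒᵖ B] :
    _root_.Equivalence (CrossedExtension.Rel (R := R) (B := B)) ∧
    ∃ e : H3 R B ≃ Crext R B,
      (∀ φ : Z3 R B, e (QuotientAddGroup.mk φ) = Quot.mk _ (skeletal φ)) ∧
      ∀ X : CrossedExtension R B,
        (∃ φ : C3 R B, X.IsCharacteristic φ.1) ∧
        ∀ φ : C3 R B, X.IsCharacteristic φ.1 →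
          ∃ hφ : φ ∈ Z3 R B, e.symm (Quot.mk _ X) = QuotientAddGroup.mk ⟨φ, hφ⟩ := by
  have hE := CrossedExtension.rel_equivalence (R := R) (B := B)
  refine ⟨hE, ?_⟩
  have rel_iff : ∀ φ ψ : Z3 R B, (QuotientAddGroup.mk φ : H3 R B) = QuotientAddGroup.mk ψ ↔
      (skeletal φ).Rel (skeletal ψ) := fun φ ψ => by
    rw [QuotientAddGroup.eq, rel_skeletal_iff, AddSubgroup.mem_addSubgroupOf, neg_add_eq_sub]
    rfl
  -- `Quot` identifies along the generated equivalence relation, which is `Rel` itself by `hE`.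
  have quot_iff : ∀ X Y : CrossedExtension R B,
      (Quot.mk _ X : Crext R B) = Quot.mk _ Y ↔ X.Rel Y := fun X Y =>
    Quot.eq.trans ⟨fun h => hE.eqvGen_iff.1 h, fun h => Relation.EqvGen.rel _ _ h⟩
  -- This gives both surjectivity and the inverse: `X` is related to the skeletal ring of any of its
  -- normalized cochains.
  have rel_skeletal : ∀ (X : CrossedExtension R B) (φ : C3 R B) (V : X.Valuation),
      V.cochain = φ.1 → ∃ hφ : φ ∈ Z3 R B, X.Rel (skeletal ⟨φ, hφ⟩) := fun X φ V hV => by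
    have hφ : φ ∈ Z3 R B := by
      change φ.1.IsCocycle
      rw [← hV]
      exact V.isCocycle_cochain
    refine ⟨hφ, CrossedExtension.rel_of_cochain_eq (V := V) (W := skeletalValuation ⟨φ, hφ⟩) ?_ ?_⟩
    · rw [hV]
      exact φ.2
    · rw [hV, skeletalValuation_cochain]
  have exists_normalized : ∀ X : CrossedExtension R B, ∃ (φ : C3 R B) (V : X.Valuation),
      V.cochain = φ.1 := fun X => by
    obtain ⟨V⟩ := X.nonempty_valuation
    obtain ⟨W, hW⟩ := V.exists_isNormalized
    exact ⟨⟨W.cochain, hW⟩, W, rfl⟩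
  let f : H3 R B → Crext R B := fun c => Quotient.liftOn' c (fun φ => Quot.mk _ (skeletal φ))
    fun φ ψ h => (quot_iff _ _).2 ((rel_iff φ ψ).1 (Quotient.sound' h))
  have hf : Function.Bijective f := by
    constructor
    · intro c d
      induction c using QuotientAddGroup.induction_on with | H φ => ?_
      induction d using QuotientAddGroup.induction_on with | H ψ => ?_
      exact fun h => (rel_iff φ ψ).2 ((quot_iff _ _).1 h)
    · intro q
      induction q using Quot.ind with | mk X => ?_
      obtain ⟨φ, V, hV⟩ := exists_normalized X
      obtain ⟨hφ, h⟩ := rel_skeletal X φ V hV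
      exact ⟨QuotientAddGroup.mk ⟨φ, hφ⟩, (quot_iff _ _).2 (hE.symm h)⟩
  refine ⟨Equiv.ofBijective f hf, fun φ => rfl, fun X => ⟨?_, fun φ h => ?_⟩⟩
  · obtain ⟨φ, V, hV⟩ := exists_normalized X
    exact ⟨φ, hV ▸ V.isCharacteristic_cochain⟩
  · obtain ⟨V⟩ := X.nonempty_valuation
    obtain ⟨W, hW⟩ := V.exists_cochain_eq h
    obtain ⟨hφ, hX⟩ := rel_skeletal X φ W hW
    refine ⟨hφ, ?_⟩
    exact (Equiv.symm_apply_eq _).2 ((quot_iff _ _).2 hX)
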